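/- **Data words.** Let $A = A_S \uplus A_E$ be a finite alphabet of actions, split into actions of System and actions of Environment, and let $P_S, P_E$ be disjoint finite sets of processes (owned by System and Environment respectively; no process is shared). Put $\Sigma_S = A_S\times P_S$, $\Sigma_E = A_E\times P_E$, $\Sigma=\Sigma_S\cup\Sigma_E$. A data word is a finite or infinite sequence $w=(a_0,p_0)(a_1,p_1)\cdots$ over $\Sigma$. It is viewed as a relational structure whose domain consists of the positions of $w$ and of the processes in $P_S\cup P_E$. **Logic.** Formulas of $\mathrm{FO}^2[\sim,+1]$ over $A$ are built from the atoms $a(x)$ (for $a\in A$), $x=y$, $x=y+1$, $x\sim y$, $P_S(x)$, $P_E(x)$, $P_M(x)$ by $\neg,\wedge,\vee,\exists,\forall$, where only two (reusable) variables occur. Here $a(x)$ says that $x$ is a position with action $a$; $x=y+1$ says that $x,y$ are positions and $x$ is the immediate successor of $y$; $\sim$ is the equivalence relation "same process", where a position $(a,p)$ has process $p$ and a process $p$ has process $p$; $P_S(x)$, $P_E(x)$ say that $x$ is a process in $P_S$, $P_E$; and $P_M(x)$ says that $x$ is a shared process (so it never holds here). **Game.** A strategy of System is a function $S:\Sigma^*\to\Sigma_S\cup\{\varepsilon\}$.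 A data word $w=\sigma_0\sigma_1\cdots$ is $S$-compatible if $\sigma_i\in\Sigma_S$ implies $\sigma_i=S(\sigma_0\cdots\sigma_{i-1})$ for every $i<|w|$, and, if $w$ is finite, $S(w)=\varepsilon$. It is fair for $S$ if, whenever $S(\sigma_0\cdots\sigma_{i-1})\ne\varepsilon$ for infinitely many $i<|w|$, there are infinitely many $i$ with $\sigma_i\in\Sigma_S$. The strategy $S$ is winning for a sentence $\varphi$ if every $S$-compatible data word that is fair for $S$ satisfies $\varphi$. **Theorem.** The following problem $\mathrm{PARTSYNTH}[\mathrm{FO}^2[\sim,+1]]$ is undecidable: given a finite alphabet $A=A_S\uplus A_E$ and a sentence $\varphi$ of $\mathrm{FO}^2[\sim,+1]$ over $A$, decide whether there are finite sets $P_S$ and $P_E$ of processes for which System has a winning strategy for $\varphi$. -/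

import Mathlib

namespace DataWordSynthesis

/-! ### Formulas of the two-variable logic `FO²[∼, +1]` -/

/-- The two reusable variables. -/
abbrev Var := Fin 2

/-- Names of actions: `Sum.inl i` is the `i`-th action of System, `Sum.inr i` is the `i`-th action
of Environment. -/
abbrev ActionName := ℕ ⊕ ℕ

/-- Formulas of first-order logic with the two variables `0` and `1`, with the data relation `∼` and
the successor relation `+1` on positions. -/
inductive Formula : Type
  /-- `a(x)` -/
  | letter (a : ActionName) (x : Var)
  /-- `x = y` -/
  | eq (x y : Var)
  /-- `x = y + 1` -/
  | succ (x y : Var)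
  /-- `x ∼ y` -/
  | sim (x y : Var)
  /-- `x` is a process of System -/
  | procS (x : Var)
  /-- `x` is a process of Environment -/
  | procE (x : Var)
  /-- `x` is a process shared by both players -/
  | procM (x : Var)
  | not (φ : Formula)
  | and (φ ψ : Formula)
  | or (φ ψ : Formula)
  | ex (x : Var) (φ : Formula)
  | all (x : Var) (φ : Formula)

namespace Formula

/-- The free variables of a formula. -/
def freeVars : Formula → Finset Var
  | letter _ x => {x}
  | eq x y => {x, y}
  | succ x y => {x, y}
  | sim x y => {x, y}
  | procS x => {x}
  | procE x => {x}
  | procM x => {x}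
  | not φ => φ.freeVars
  | and φ ψ => φ.freeVars ∪ ψ.freeVars
  | or φ ψ => φ.freeVars ∪ ψ.freeVars
  | ex x φ => φ.freeVars.erase x
  | all x φ => φ.freeVars.erase x

/-- A sentence is a formula without free variables. -/
def IsSentence (φ : Formula) : Prop := φ.freeVars = ∅

/-- All actions named in the formula belong to the alphabet that consists of the first `kS` actions
of System and the first `kE` actions of Environment. -/
def OverAlphabet (kS kE : ℕ) : Formula → Prop
  | letter (Sum.inl i) _ => i < kS
  | letter (Sum.inr i) _ => i < kE
  | eq _ _ => True
  | succ _ _ => True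
  | sim _ _ => True
  | procS _ => True
  | procE _ => True
  | procM _ => True
  | not φ => φ.OverAlphabet kS kE
  | and φ ψ => φ.OverAlphabet kS kE ∧ ψ.OverAlphabet kS kE
  | or φ ψ => φ.OverAlphabet kS kE ∧ ψ.OverAlphabet kS kE
  | ex _ φ => φ.OverAlphabet kS kE
  | all _ φ => φ.OverAlphabet kS kE

/-! ### A Gödel numbering of formulas

Formulas are numbered structurally, so that they can be inputs of algorithms. -/

/-- The Gödel number of a formula. -/
def toNat : Formula → ℕ
  | eq x y => 2 * x.val + y.val
  | succ x y => 2 * x.val + y.val + 4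
  | sim x y => 2 * x.val + y.val + 8
  | procS x => x.val + 12
  | procE x => x.val + 14
  | procM x => x.val + 16
  | letter a x => 6 * (2 * Encodable.encode a + x.val) + 18
  | not φ => 6 * φ.toNat + 19
  | and φ ψ => 6 * Nat.pair φ.toNat ψ.toNat + 20
  | or φ ψ => 6 * Nat.pair φ.toNat ψ.toNat + 21
  | ex x φ => 6 * (2 * φ.toNat + x.val) + 22
  | all x φ => 6 * (2 * φ.toNat + x.val) + 23

/-- The variable given by the parity of a number. -/
def varOfNat (n : ℕ) : Var := ⟨n % 2, Nat.mod_lt _ (by norm_num)⟩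

/-- The formula with a given Gödel number. -/
def ofNat (n : ℕ) : Formula :=
  if n < 4 then eq (varOfNat (n / 2)) (varOfNat n)
  else if n < 8 then succ (varOfNat (n / 2)) (varOfNat n)
  else if n < 12 then sim (varOfNat (n / 2)) (varOfNat n)
  else if n < 14 then procS (varOfNat n)
  else if n < 16 then procE (varOfNat n)
  else if h : n < 18 then procM (varOfNat n)
  else
    let k := (n - 18) / 6
    have h0 : k < n := by omega
    have h1 : k / 2 < n := by omega
    have h2 : k.unpair.1 < n := lt_of_le_of_lt k.unpair_left_le h0
    have h3 : k.unpair.2 < n := lt_of_le_of_lt k.unpair_right_le h0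
    match (n - 18) % 6 with
    | 0 => letter (Denumerable.ofNat ActionName (k / 2)) (varOfNat k)
    | 1 => not (ofNat k)
    | 2 => and (ofNat k.unpair.1) (ofNat k.unpair.2)
    | 3 => or (ofNat k.unpair.1) (ofNat k.unpair.2)
    | 4 => ex (varOfNat k) (ofNat (k / 2))
    | _ => all (varOfNat k) (ofNat (k / 2))
  termination_by n

theorem varOfNat_add (m : ℕ) (x : Var) : varOfNat (2 * m + x.val) = x := by
  apply Fin.ext
  have := x.isLt
  simp only [varOfNat]
  omega

theorem ofNat_step (k r : ℕ) : r < 6 → ofNat (6 * k + (18 + r)) =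
    match (generalizing := false) r with
    | 0 => letter (Denumerable.ofNat ActionName (k / 2)) (varOfNat k)
    | 1 => not (ofNat k)
    | 2 => and (ofNat k.unpair.1) (ofNat k.unpair.2)
    | 3 => or (ofNat k.unpair.1) (ofNat k.unpair.2)
    | 4 => ex (varOfNat k) (ofNat (k / 2))
    | _ => all (varOfNat k) (ofNat (k / 2)) := by
  intro hr
  have hk : (6 * k + (18 + r) - 18) / 6 = k := by omega
  have hm : (6 * k + (18 + r) - 18) % 6 = r := by omega
  rw [ofNat]
  rw [if_neg (by omega), if_neg (by omega), if_neg (by omega), if_neg (by omega),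
    if_neg (by omega), dif_neg (by omega)]
  simp only [hk, hm]

theorem ofNat_toNat (φ : Formula) : ofNat φ.toNat = φ := by
  have half (m : ℕ) (x : Var) : (2 * m + x.val) / 2 = m := by
    have := x.isLt
    omega
  induction φ with
  | eq x y => fin_cases x <;> fin_cases y <;> simp [toNat, ofNat, varOfNat]
  | succ x y => fin_cases x <;> fin_cases y <;> simp [toNat, ofNat, varOfNat]
  | sim x y => fin_cases x <;> fin_cases y <;> simp [toNat, ofNat, varOfNat]
  | procS x => fin_cases x <;> simp [toNat, ofNat, varOfNat]
  | procE x => fin_cases x <;> simp [toNat, ofNat, varOfNat]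
  | procM x => fin_cases x <;> simp [toNat, ofNat, varOfNat]
  | letter a x =>
    have := ofNat_step (2 * Encodable.encode a + x.val) 0 (by norm_num)
    simpa only [toNat, Nat.reduceAdd, half, varOfNat_add, Denumerable.ofNat_encode] using this
  | not φ ih => simpa only [toNat, ih, Nat.reduceAdd] using ofNat_step φ.toNat 1 (by norm_num)
  | and φ ψ ih1 ih2 =>
    simpa only [toNat, Nat.reduceAdd, Nat.unpair_pair, ih1, ih2] using
      ofNat_step (Nat.pair φ.toNat ψ.toNat) 2 (by norm_num)
  | or φ ψ ih1 ih2 =>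
    simpa only [toNat, Nat.reduceAdd, Nat.unpair_pair, ih1, ih2] using
      ofNat_step (Nat.pair φ.toNat ψ.toNat) 3 (by norm_num)
  | ex x φ ih =>
    simpa only [toNat, Nat.reduceAdd, half, varOfNat_add, ih] using
      ofNat_step (2 * φ.toNat + x.val) 4 (by norm_num)
  | all x φ ih =>
    simpa only [toNat, Nat.reduceAdd, half, varOfNat_add, ih] using
      ofNat_step (2 * φ.toNat + x.val) 5 (by norm_num)

theorem toNat_ofNat (n : ℕ) : (ofNat n).toNat = n := by
  induction n using Nat.strong_induction_on with
  | _ n ih =>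
    by_cases h : n < 18
    · interval_cases n <;> simp [toNat, ofNat, varOfNat]
    · obtain ⟨k, r, hr, rfl⟩ : ∃ k r, r < 6 ∧ n = 6 * k + (18 + r) :=
        ⟨(n - 18) / 6, (n - 18) % 6, Nat.mod_lt _ (by norm_num), by omega⟩
      have ih0 := ih k (by omega)
      have ih1 := ih (k / 2) (by omega)
      have ih2 := ih k.unpair.1 (lt_of_le_of_lt k.unpair_left_le (by omega))
      have ih3 := ih k.unpair.2 (lt_of_le_of_lt k.unpair_right_le (by omega))
      rw [ofNat_step k r hr]
      interval_cases r <;>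
        simp only [toNat, ih0, ih1, ih2, ih3, Nat.pair_unpair, Denumerable.encode_ofNat,
          varOfNat] <;> omega

/-- Formulas are in bijection with natural numbers. -/
def equivNat : Formula ≃ ℕ := ⟨toNat, ofNat, ofNat_toNat, toNat_ofNat⟩

instance : Denumerable Formula := Denumerable.mk' equivNat

end Formula

/-! ### Data words -/

/-- The sizes of the finite sets on which a game is played: the actions of each player, and the
processes belonging to System, to Environment, and to both. -/
structure Arena where
  actS : ℕ
  actE : ℕ
  procS : ℕ
  procE : ℕ
  procM : ℕ

namespace Arena

variable (A : Arena)

/-- All processes. -/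
abbrev Proc : Type := Fin A.procS ⊕ Fin A.procE ⊕ Fin A.procM

/-- The moves of System: an action of System, on a process that System may use. -/
abbrev VocabS : Type := Fin A.actS × (Fin A.procS ⊕ Fin A.procM)

/-- The moves of Environment: an action of Environment, on a process that Environment may use. -/
abbrev VocabE : Type := Fin A.actE × (Fin A.procE ⊕ Fin A.procM)

/-- All moves. -/
abbrev Vocab : Type := A.VocabS ⊕ A.VocabE

variable {A}

/-- The action of a move. -/
def action : A.Vocab → ActionName
  | Sum.inl (a, _) => Sum.inl a.val
  | Sum.inr (a, _) => Sum.inr a.val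

/-- The process of a move. -/
def proc : A.Vocab → A.Proc
  | Sum.inl (_, Sum.inl p) => Sum.inl p
  | Sum.inl (_, Sum.inr p) => Sum.inr (Sum.inr p)
  | Sum.inr (_, Sum.inl p) => Sum.inr (Sum.inl p)
  | Sum.inr (_, Sum.inr p) => Sum.inr (Sum.inr p)

end Arena

/-- A data word: a finite or infinite sequence of moves. -/
abbrev DataWord (A : Arena) : Type := Stream'.Seq A.Vocab

namespace DataWord

variable {A : Arena} (w : DataWord A)

/-- The domain of a data word as a relational structure: its positions and all processes. -/
abbrev Dom : Type := {i : ℕ // (w.get? i).isSome} ⊕ A.Proc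

/-- The move at a position. -/
def moveAt (i : {i : ℕ // (w.get? i).isSome}) : A.Vocab := (w.get? i.val).get i.property

/-- The process of an element of the domain: for a position, the process on which the move is made;
for a process, itself. -/
def procOf : w.Dom → A.Proc
  | Sum.inl i => Arena.proc (w.moveAt i)
  | Sum.inr p => p

/-- The element is a position at which the action is played. -/
def HasAction (a : ActionName) : w.Dom → Prop
  | Sum.inl i => Arena.action (w.moveAt i) = a
  | Sum.inr _ => False

/-- `IsSucc d e` : both are positions and `d = e + 1`. -/
def IsSucc : w.Dom → w.Dom → Prop
  | Sum.inl i, Sum.inl j => i.val = j.val + 1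
  | _, _ => False

/-- Satisfaction of a formula under a partial assignment of the variables. An atomic formula in which
some variable has no value does not hold; this never occurs in the evaluation of a sentence. -/
def Sat : Formula → (Var → Option w.Dom) → Prop
  | .letter a x, v => ∃ d, v x = some d ∧ w.HasAction a d
  | .eq x y, v => ∃ d e, v x = some d ∧ v y = some e ∧ d = e
  | .succ x y, v => ∃ d e, v x = some d ∧ v y = some e ∧ w.IsSucc d e
  | .sim x y, v => ∃ d e, v x = some d ∧ v y = some e ∧ w.procOf d = w.procOf e
  | .procS x, v => ∃ p, v x = some (Sum.inr (Sum.inl p))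
  | .procE x, v => ∃ p, v x = some (Sum.inr (Sum.inr (Sum.inl p)))
  | .procM x, v => ∃ p, v x = some (Sum.inr (Sum.inr (Sum.inr p)))
  | .not φ, v => ¬ Sat φ v
  | .and φ ψ, v => Sat φ v ∧ Sat ψ v
  | .or φ ψ, v => Sat φ v ∨ Sat ψ v
  | .ex x φ, v => ∃ d : w.Dom, Sat φ (Function.update v x (some d))
  | .all x φ, v => ∀ d : w.Dom, Sat φ (Function.update v x (some d))

/-- The data word satisfies the sentence. -/
def Models (φ : Formula) : Prop := w.Sat φ (fun _ => none)

end DataWord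

/-! ### The synthesis problem -/

/-- A strategy of System: after each history it makes a move of System or passes (`none`). -/
abbrev Strategy (A : Arena) : Type := List A.Vocab → Option A.VocabS

namespace Strategy

variable {A : Arena} (S : Strategy A)

/-- Every move of System in the execution is the one given by the strategy, and if the execution is
finite then the strategy passes at its end. -/
def Compatible (w : DataWord A) : Prop :=
  (∀ (i : ℕ) (s : A.VocabS), w.get? i = some (Sum.inl s) → S (w.take i) = some s) ∧
  (∀ h : w.Terminates, S (w.toList h) = none)

/-- If the strategy wants to move infinitely often along the execution, then System moves infinitely
often. -/
def Fair (w : DataWord A) : Prop :=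
  {i : ℕ | (w.get? i).isSome ∧ S (w.take i) ≠ none}.Infinite →
  {i : ℕ | ∃ s : A.VocabS, w.get? i = some (Sum.inl s)}.Infinite

/-- All compatible fair executions satisfy the formula. -/
def Winning (φ : Formula) : Prop :=
  ∀ w : DataWord A, S.Compatible w → S.Fair w → w.Models φ

end Strategy

/-- The synthesis problem for `FO²[∼, +1]` with partitioned processes. An input consists of the number
of actions of System, the number of actions of Environment, and a formula. It is a positive instance
if the formula is a sentence over this alphabet, and System has a winning strategy for it with some
finite numbers of processes of System and of Environment and without shared processes. -/
def PartSynthFO2SimSucc : ℕ × ℕ × Formula → Prop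
  | (kS, kE, φ) => φ.OverAlphabet kS kE ∧ φ.IsSentence ∧
      ∃ nS nE : ℕ, ∃ S : Strategy ⟨kS, kE, nS, nE, 0⟩, S.Winning φ

end DataWordSynthesis

namespace DataWordSynthesis

/-! Halting of a counter machine is reduced to the synthesis problem. System writes a run as a word
alternating state letters and instruction letters. A counter is stored in unary: its value is the
number of processes on which it has been incremented and not decremented. Each process is
incremented at most once, so a run needs many processes; since their number is quantified
existentially, a finite run always fits.

Two variables without an order on positions cannot check a whole run, so the checking is left to
Environment. The formula is true if Environment moves twice. If Environment never moves, the final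
state must occur. If Environment moves once, that move must be the last position and the System move
just before it must be correct. For that last System move, "earlier" just means "another System
position", so freshness of an incremented process, activity of a decremented one and emptiness of a
counter need only `∼` and two variables, and the window of a rule needs only the successor. System
cannot foresee the challenge, so every move of its unchallenged play must be correct. Conversely,
replaying a halting run and falling silent after a challenge wins. The first conjunct demands an
Environment process, since otherwise no challenge would be possible. This is `exists_winning_iff`,
resting on `models_machineFormula_iff` (semantics) and `exists_allOK_iff` (words versus runs).

The undecidable source is one fixed three-counter machine with varying input. A fixed universal
partial recursive code is compiled to a Turing machine; its half-tapes become numbers in base `b`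
held in two counters, the third serving for multiplication and division by `b` (`reaches_halt_iff`).
The game starts with all counters zero, so the input `m` is loaded by a chain of `m` new increment
rules (`cReaches_loadRules_iff`), which keeps the formula primitive recursive in `m`. -/

/-! ### Counter machines with three counters -/

/-- The instructions of a counter machine. -/
inductive Op : Type
  | inc (c : Fin 3)
  | dec (c : Fin 3)
  | zero (c : Fin 3)

namespace Op

/-- The effect of an instruction on the counters. -/
def Act : Op → (Fin 3 → ℕ) → (Fin 3 → ℕ) → Prop
  | inc c, v, v' => v' = Function.update v c (v c + 1)
  | dec c, v, v' => v c ≠ 0 ∧ v' = Function.update v c (v c - 1)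
  | zero c, v, v' => v c = 0 ∧ v' = v

/-- The letter of an instruction. -/
def letter : Op → ℕ
  | inc c => c
  | dec c => 3 + c
  | zero c => 6 + c

theorem letter_lt (o : Op) : o.letter < 9 := by
  cases o <;> simp only [letter] <;> omega

theorem letter_injective : Function.Injective letter := by
  intro o o' h
  cases o <;> cases o' <;> simp only [letter, inc.injEq, dec.injEq, zero.injEq, reduceCtorEq] at h ⊢
    <;> omega

/-- All instructions. -/
def list : List Op :=
  [inc 0, inc 1, inc 2, dec 0, dec 1, dec 2, zero 0, zero 1, zero 2]

theorem mem_list (o : Op) : o ∈ list := by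
  cases o with | _ c => fin_cases c <;> simp [list]

end Op

/-- A rule of a counter machine: in a state, execute an instruction and enter a new state. -/
abbrev Rule : Type := ℕ × Op × ℕ

/-- One step of the counter machine with the given rules. -/
def CStep (Δ : List Rule) (x y : ℕ × (Fin 3 → ℕ)) : Prop :=
  ∃ o, (x.1, o, y.1) ∈ Δ ∧ o.Act x.2 y.2

/-- The machine reaches state `f` from state `s` with the given values of the counters. -/
def CReaches (Δ : List Rule) (s : ℕ) (v : Fin 3 → ℕ) (f : ℕ) : Prop :=
  ∃ v', Relation.ReflTransGen (CStep Δ) (s, v) (f, v')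

/-! ### Runs of counter machines as words of letters and data -/

/-- The letter of a state. -/
def stateLetter (q : ℕ) : ℕ := 9 + q

theorem op_letter_ne_stateLetter (o : Op) (q : ℕ) : o.letter ≠ stateLetter q := by
  have := o.letter_lt
  simp only [stateLetter]
  omega

/-- The data that occur with a letter. -/
def dataOf (a : ℕ) (h : List (ℕ × ℕ)) : Finset ℕ :=
  ((h.filter (fun x => x.1 = a)).map Prod.snd).toFinset

theorem mem_dataOf {a p : ℕ} {h : List (ℕ × ℕ)} : p ∈ dataOf a h ↔ (a, p) ∈ h := by
  simp [dataOf]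

/-- The data that are active for a counter: incremented and not decremented. -/
def activeData (c : Fin 3) (h : List (ℕ × ℕ)) : Finset ℕ :=
  dataOf (Op.inc c).letter h \ dataOf (Op.dec c).letter h

theorem mem_activeData {c : Fin 3} {p : ℕ} {h : List (ℕ × ℕ)} :
    p ∈ activeData c h ↔ ((Op.inc c).letter, p) ∈ h ∧ ((Op.dec c).letter, p) ∉ h := by
  simp [activeData, mem_dataOf]

/-- The values of the counters after a word. -/
def counts (h : List (ℕ × ℕ)) (c : Fin 3) : ℕ := (activeData c h).card

/-- The condition for executing an instruction on a datum. -/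
def Op.OK : Op → List (ℕ × ℕ) → ℕ → Prop
  | .inc _, h, p => ∀ a, (a, p) ∉ h
  | .dec c, h, p => p ∈ activeData c h
  | .zero c, h, _ => activeData c h = ∅

theorem activeData_append_of_ne {c : Fin 3} {a p : ℕ} {h : List (ℕ × ℕ)}
    (h1 : a ≠ (Op.inc c).letter) (h2 : a ≠ (Op.dec c).letter) :
    activeData c (h ++ [(a, p)]) = activeData c h := by
  ext p'
  simp [mem_activeData, h1.symm, h2.symm]

theorem counts_append_state (h : List (ℕ × ℕ)) (q p : ℕ) :
    counts (h ++ [(stateLetter q, p)]) = counts h := by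
  funext c
  rw [counts, counts, activeData_append_of_ne (op_letter_ne_stateLetter _ _).symm
    (op_letter_ne_stateLetter _ _).symm]

theorem activeData_append_op_of_ne {c : Fin 3} {o : Op} {p : ℕ} {h : List (ℕ × ℕ)}
    (h1 : o ≠ .inc c) (h2 : o ≠ .dec c) :
    activeData c (h ++ [(o.letter, p)]) = activeData c h :=
  activeData_append_of_ne (fun e => h1 (Op.letter_injective e))
    (fun e => h2 (Op.letter_injective e))

/-- An instruction alters only the active set of its own counter: an increment inserts a new
element, a decrement erases a present one, and a zero test touches no active set. -/
theorem Op.OK.act {o : Op} {h : List (ℕ × ℕ)} {p : ℕ} (ok : o.OK h p) :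
    o.Act (counts h) (counts (h ++ [(o.letter, p)])) := by
  cases o with
  | inc c =>
    funext c'
    by_cases hc : c' = c
    · subst hc
      have : activeData c' (h ++ [((Op.inc c').letter, p)]) = insert p (activeData c' h) := by
        ext p'
        -- Freshness is also needed for the decrement letter: a datum already decremented would not
        -- become active.
        have := ok (Op.dec c').letter
        simp only [mem_activeData, List.mem_append, List.mem_singleton, Prod.mk.injEq,
          Op.letter_injective.eq_iff, Finset.mem_insert]
        by_cases hp : p' = p <;> simp [hp, this]
      have hp : p ∉ activeData c' h := fun hp => ok _ (mem_activeData.1 hp).1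
      simp [counts, this, Finset.card_insert_of_notMem hp]
    · simp only [ne_eq, hc, not_false_eq_true, Function.update_of_ne, counts]
      rw [activeData_append_op_of_ne] <;> simp [Ne.symm hc]
  | dec c =>
    refine ⟨Finset.card_ne_zero_of_mem ok, ?_⟩
    funext c'
    by_cases hc : c' = c
    · subst hc
      have : activeData c' (h ++ [((Op.dec c').letter, p)]) = (activeData c' h).erase p := by
        ext p'
        simp only [mem_activeData, List.mem_append, List.mem_singleton, Prod.mk.injEq,
          Op.letter_injective.eq_iff, Finset.mem_erase]
        by_cases hp : p' = p <;> simp [hp]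
      simp only [counts, this, Function.update_self]
      rw [Finset.card_erase_of_mem ok]
    · simp only [ne_eq, hc, not_false_eq_true, Function.update_of_ne, counts]
      rw [activeData_append_op_of_ne] <;> simp [Ne.symm hc]
  | zero c =>
    refine ⟨Finset.card_eq_zero.2 ok, ?_⟩
    funext c'
    rw [counts, counts, activeData_append_op_of_ne] <;> simp

/-- Data range over all of `ℕ` at this stage, so a fresh one always exists; the number of processes
is fixed only once the whole run is known. -/
theorem Op.Act.exists_ok {o : Op} {h : List (ℕ × ℕ)} {v : Fin 3 → ℕ} (act : o.Act (counts h) v) :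
    ∃ p, o.OK h p := by
  cases o with
  | inc c =>
    obtain ⟨p, hp⟩ := Infinite.exists_notMem_finset (h.map Prod.snd).toFinset
    refine ⟨p, fun a ha => hp ?_⟩
    simp only [List.mem_toFinset, List.mem_map]
    exact ⟨_, ha, rfl⟩
  | dec c => exact Finset.card_ne_zero.1 act.1
  | zero c => exact ⟨0, Finset.card_eq_zero.1 act.1⟩

theorem Op.Act.unique {o : Op} {v v₁ v₂ : Fin 3 → ℕ} (h₁ : o.Act v v₁) (h₂ : o.Act v v₂) :
    v₁ = v₂ := by
  cases o with
  | inc c => exact h₁.trans h₂.symm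
  | dec c => exact h₁.2.trans h₂.2.symm
  | zero c => exact h₁.2.trans h₂.2.symm

/-- The condition for extending a word by a letter with a datum. -/
def ExtOK (Δ : List Rule) (s : ℕ) (h : List (ℕ × ℕ)) (x : ℕ × ℕ) : Prop :=
  (x.1 = stateLetter s ∧ h = []) ∨
  (∃ o : Op, x.1 = o.letter ∧ o.OK h x.2) ∨
  (∃ r ∈ Δ, x.1 = stateLetter r.2.2 ∧
    ∃ h' p₁ p₂, h = h' ++ [(stateLetter r.1, p₁), (r.2.1.letter, p₂)])

/-- Every letter of the word satisfies its condition. -/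
inductive AllOK (Δ : List Rule) (s : ℕ) : List (ℕ × ℕ) → Prop
  | nil : AllOK Δ s []
  | snoc (h x) : AllOK Δ s h → ExtOK Δ s h x → AllOK Δ s (h ++ [x])

theorem allOK_append_singleton {Δ : List Rule} {s : ℕ} {h : List (ℕ × ℕ)} {x : ℕ × ℕ} :
    AllOK Δ s (h ++ [x]) ↔ AllOK Δ s h ∧ ExtOK Δ s h x := by
  refine ⟨fun H => ?_, fun H => .snoc _ _ H.1 H.2⟩
  generalize hl : h ++ [x] = l at H
  cases H with
  | nil => simp at hl
  | snoc h' x' H1 H2 =>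
    obtain ⟨rfl, hx⟩ := List.append_inj' hl rfl
    obtain rfl : x = x' := by simpa using hx
    exact ⟨H1, H2⟩

/-- `ExtOK` lets an instruction letter occur anywhere, but a state letter must either open the word
or complete a window state, instruction, state of a rule. Tracing back from a final state letter,
two letters at a time, therefore recovers an entire run. -/
theorem AllOK.reaches {Δ : List Rule} {s : ℕ} : ∀ (n : ℕ) {h : List (ℕ × ℕ)} {q p : ℕ},
    h.length = n → AllOK Δ s (h ++ [(stateLetter q, p)]) →
    Relation.ReflTransGen (CStep Δ) (s, fun _ => 0) (q, counts (h ++ [(stateLetter q, p)])) := by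
  intro n
  induction n using Nat.strong_induction_on with
  | _ n ih =>
    intro h q p hn H
    rw [counts_append_state]
    obtain ⟨H1, ⟨hq, rfl⟩ | ⟨o, ho, -⟩ | ⟨r, hr, hq, h', p₁, p₂, rfl⟩⟩ :=
      allOK_append_singleton.1 H
    · obtain rfl : q = s := by simpa [stateLetter] using hq
      have : counts [] = fun _ => 0 := by funext c; simp [counts, activeData, dataOf]
      rw [this]
    · exact absurd ho.symm (op_letter_ne_stateLetter _ _)
    · obtain rfl : q = r.2.2 := by simpa [stateLetter] using hq
      rw [List.append_cons] at H1 ⊢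
      obtain ⟨H2, H3⟩ := allOK_append_singleton.1 H1
      refine (ih h'.length (by subst hn; simp) rfl H2).tail ⟨r.2.1, hr, ?_⟩
      obtain ⟨hq, -⟩ | ⟨o, ho, hok⟩ | ⟨r', hr', hq', -⟩ := H3
      · exact absurd hq (op_letter_ne_stateLetter _ _)
      · rw [Op.letter_injective ho] at *
        exact hok.act
      · exact absurd hq' (op_letter_ne_stateLetter _ _)

theorem exists_allOK_of_reaches {Δ : List Rule} {s : ℕ} {y : ℕ × (Fin 3 → ℕ)}
    (H : Relation.ReflTransGen (CStep Δ) (s, fun _ => 0) y) :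
    ∃ h, AllOK Δ s (h ++ [(stateLetter y.1, 0)]) ∧
      counts (h ++ [(stateLetter y.1, 0)]) = y.2 := by
  induction H with
  | refl =>
    refine ⟨[], .snoc _ _ .nil (Or.inl ⟨rfl, rfl⟩), ?_⟩
    funext c
    rw [counts_append_state]
    simp [counts, activeData, dataOf]
  | @tail y z _ hstep ih =>
    obtain ⟨h, hok, hc⟩ := ih
    obtain ⟨o, ho, hact⟩ := hstep
    rw [← hc] at hact
    obtain ⟨p, hp⟩ := hact.exists_ok
    -- State letters all carry the datum 0: they belong to no active set, and increments choose data
    -- that have not occurred.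
    refine ⟨(h ++ [(stateLetter y.1, 0)]) ++ [(o.letter, p)],
      .snoc _ _ (.snoc _ _ hok (Or.inr (Or.inl ⟨o, rfl, hp⟩)))
        (Or.inr (Or.inr ⟨_, ho, rfl, h, 0, p, by simp⟩)), ?_⟩
    rw [counts_append_state]
    exact hp.act.unique hact

theorem exists_allOK_iff {Δ : List Rule} {s f : ℕ} :
    (∃ h p, AllOK Δ s (h ++ [(stateLetter f, p)])) ↔ CReaches Δ s (fun _ => 0) f :=
  ⟨fun ⟨_, _, H⟩ => ⟨_, H.reaches _ rfl⟩,
    fun ⟨_, H⟩ => let ⟨h, H1, _⟩ := exists_allOK_of_reaches H; ⟨h, 0, H1⟩⟩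

/-! ### The formula of a counter machine -/

namespace Formula

/-- The element is a position with a move of Environment, if no process is shared. The second
variable is auxiliary. -/
def envPos (x y : Var) : Formula := and (not (procE x)) (ex y (and (procE y) (sim x y)))

/-- The position is labelled with the given action of System. -/
def sys (a : ℕ) (x : Var) : Formula := letter (Sum.inl a) x

/-- A disjunction, for formulas about a position assigned to the second variable in games without
shared processes. -/
def disj (l : List Formula) : Formula := l.foldr or (procM 1)

/-- There are two moves of Environment. -/
def twoEnv : Formula := ex 0 (and (envPos 0 1) (ex 1 (and (envPos 1 0) (not (eq 0 1)))))

/-- There is no move of Environment. -/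
def noEnv : Formula := not (ex 0 (envPos 0 1))

/-- There is a final move of Environment, and the position before it satisfies the formula. -/
def lastEnv (φ : Formula) : Formula :=
  ex 0 (and (envPos 0 1) (and (not (ex 1 (succ 1 0))) (all 1 (or (not (succ 0 1)) φ))))

/-- The condition on the process of an instruction at the last move of System. -/
def opCheck : Op → Formula
  | .inc _ => all 0 (or (not (sim 0 1)) (or (eq 0 1) (procS 0)))
  | .dec c => and (ex 0 (and (sim 0 1) (sys (Op.inc c).letter 0)))
      (not (ex 0 (and (and (sim 0 1) (sys (Op.dec c).letter 0)) (not (eq 0 1)))))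
  | .zero c => not (ex 0 (and (sys (Op.inc c).letter 0)
      (not (ex 1 (and (sim 0 1) (sys (Op.dec c).letter 1))))))

/-- The last move of System executes an instruction correctly. -/
def opFormula (o : Op) : Formula := and (sys o.letter 1) (opCheck o)

/-- The last move of System completes the application of a rule. -/
def ruleFormula (r : Rule) : Formula :=
  and (sys (stateLetter r.2.2) 1) (ex 0 (and (and (succ 1 0) (sys r.2.1.letter 0))
    (ex 1 (and (succ 0 1) (sys (stateLetter r.1) 1)))))

/-- The last move of System is the first move and starts the machine. -/
def startFormula (s : ℕ) : Formula := and (sys (stateLetter s) 1) (not (ex 0 (succ 1 0)))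

/-- The last move of System is correct. -/
def extFormula (s : ℕ) (Δ : List Rule) : Formula :=
  or (startFormula s) (or (disj (Op.list.map opFormula)) (disj (Δ.map ruleFormula)))

/-- The formula that forces System to simulate the machine until it reaches its final state. -/
def machineFormula (s : ℕ) (Δ : List Rule) (f : ℕ) : Formula :=
  and (ex 0 (procE 0)) (or twoEnv (or (and noEnv (ex 0 (sys (stateLetter f) 0)))
    (lastEnv (extFormula s Δ))))

end Formula

/-! ### Its meaning -/

/-- The arenas of the games played on the formula. -/
abbrev machineArena (kS nS nE : ℕ) : Arena := ⟨kS, 1, nS, nE, 0⟩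

variable {kS nS nE : ℕ}

/-- The letter and the datum of a move of System. -/
def moveData (s : (machineArena kS nS nE).VocabS) : ℕ × ℕ :=
  (s.1.val, s.2.elim Fin.val Fin.elim0)

theorem proc_inl_eq_iff {s s' : (machineArena kS nS nE).VocabS} :
    Arena.proc (A := machineArena kS nS nE) (Sum.inl s) = Arena.proc (Sum.inl s') ↔
      (moveData s).2 = (moveData s').2 := by
  obtain ⟨a, p | p⟩ := s
  · obtain ⟨a', p' | p'⟩ := s'
    · simp [Arena.proc, moveData, Fin.ext_iff]
    · exact p'.elim0
  · exact p.elim0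

namespace DataWord

variable (w : DataWord (machineArena kS nS nE))

/-- The element is a position with a move of System that has the given letter and datum. -/
def SysAt (d : w.Dom) (x : ℕ × ℕ) : Prop :=
  ∃ i s, d = Sum.inl i ∧ w.moveAt i = Sum.inl s ∧ moveData s = x

/-- The element is a position with a move of Environment. -/
def EnvAt (d : w.Dom) : Prop := ∃ i e, d = Sum.inl i ∧ w.moveAt i = Sum.inr e

variable {w}

theorem moveAt_eq_iff {i : {i : ℕ // (w.get? i).isSome}} {m} :
    w.moveAt i = m ↔ w.get? i.val = some m := by
  rw [moveAt, Option.eq_some_iff_get_eq]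
  exact ⟨fun h => ⟨_, h⟩, fun ⟨_, h⟩ => h⟩

theorem sat_sys {a : ℕ} {x : Var} {v : Var → Option w.Dom} {d : w.Dom} (hd : v x = some d) :
    w.Sat (.sys a x) v ↔ ∃ p, w.SysAt d (a, p) := by
  simp only [Formula.sys, Sat, hd, Option.some.injEq, exists_eq_left']
  constructor
  · intro h
    rcases d with i | p
    · rcases hi : w.moveAt i with s | e
      · simp only [HasAction, hi, Arena.action, Sum.inl.injEq] at h
        exact ⟨_, i, s, rfl, hi, Prod.ext h rfl⟩
      · simp [HasAction, hi, Arena.action] at h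
    · exact h.elim
  · rintro ⟨p, i, s, rfl, hi, hs⟩
    simp only [HasAction, hi, Arena.action, Sum.inl.injEq]
    exact congrArg Prod.fst hs

/-- Without shared processes, the elements equivalent to an Environment process are that process and
the positions on it; the first conjunct removes the process. -/
theorem sat_envPos {x y : Var} (hxy : x ≠ y) {v : Var → Option w.Dom} {d : w.Dom}
    (hd : v x = some d) : w.Sat (.envPos x y) v ↔ w.EnvAt d := by
  simp only [Formula.envPos, Sat, hd, Option.some.injEq, Function.update_self, ne_eq, hxy,
    not_false_eq_true, Function.update_of_ne]
  rcases d with i | p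
  · rcases h : w.moveAt i with ⟨a, s | s⟩ | ⟨a, e | e⟩
    · simp [EnvAt, h, procOf, Arena.proc]
    · exact s.elim0
    · simp [EnvAt, h, procOf, Arena.proc, Subsingleton.elim a 0]
    · exact e.elim0
  · simp [EnvAt, procOf]

theorem SysAt.procOf_eq_iff {d d' : w.Dom} {x x' : ℕ × ℕ} (h : w.SysAt d x) (h' : w.SysAt d' x') :
    w.procOf d = w.procOf d' ↔ x.2 = x'.2 := by
  obtain ⟨i, s, rfl, hs, rfl⟩ := h
  obtain ⟨i', s', rfl, hs', rfl⟩ := h'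
  simp only [procOf, hs, hs', proc_inl_eq_iff]

theorem sat_disj {l : List Formula} {v : Var → Option w.Dom} :
    w.Sat (.disj l) v ↔ ∃ φ ∈ l, w.Sat φ v := by
  induction l with
  | nil =>
    simp only [Formula.disj, List.foldr_nil, List.not_mem_nil, false_and, exists_false, iff_false]
    -- The base formula `procM 1` of the disjunction acts as falsity, there being no shared process.
    rintro ⟨p, -⟩
    exact p.elim0
  | cons φ l ih =>
    simp only [Formula.disj, List.foldr_cons, Sat, List.mem_cons, exists_eq_or_imp] at ih ⊢
    rw [ih]

theorem isSucc_inl_iff {i : {i : ℕ // (w.get? i).isSome}} {d : w.Dom} :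
    w.IsSucc (Sum.inl i) d ↔ ∃ j : {i : ℕ // (w.get? i).isSome}, d = Sum.inl j ∧ i.1 = j.1 + 1 := by
  rcases d with j | p <;> simp [IsSucc]

theorem sat_twoEnv {v : Var → Option w.Dom} :
    w.Sat .twoEnv v ↔ ∃ d d', w.EnvAt d ∧ w.EnvAt d' ∧ d ≠ d' := by
  simp only [Formula.twoEnv, Sat]
  refine exists_congr fun d => ?_
  rw [sat_envPos (d := d) (by decide) (by simp), ← exists_and_left]
  refine exists_congr fun d' => ?_
  rw [sat_envPos (d := d') (by decide) (by simp)]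
  simp only [ne_eq, zero_ne_one, not_false_eq_true, Function.update_of_ne, Function.update_self,
    Option.some.injEq, exists_and_left, exists_eq_left']

theorem sat_noEnv {v : Var → Option w.Dom} : w.Sat .noEnv v ↔ ∀ d, ¬ w.EnvAt d := by
  simp only [Formula.noEnv, Sat, not_exists]
  refine forall_congr' fun d => ?_
  rw [sat_envPos (d := d) (by decide) (by simp)]

theorem sat_lastEnv {φ : Formula} {v : Var → Option w.Dom} :
    w.Sat (.lastEnv φ) v ↔ ∃ d, w.EnvAt d ∧ (∀ d', ¬ w.IsSucc d' d) ∧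
      ∀ d', w.IsSucc d d' →
        w.Sat φ (Function.update (Function.update v 0 (some d)) 1 (some d')) := by
  simp only [Formula.lastEnv, Sat]
  refine exists_congr fun d => ?_
  rw [sat_envPos (d := d) (by decide) (by simp)]
  simp [imp_iff_not_or]

end DataWord

/-! ### The last move of System -/

section LastMove

variable {h : List (machineArena kS nS nE).VocabS} {s : (machineArena kS nS nE).VocabS}
  {e : (machineArena kS nS nE).VocabE}

/-- The word of moves of System that ends with a move of Environment. -/
def stopWord (h : List (machineArena kS nS nE).VocabS) (e : (machineArena kS nS nE).VocabE) :
    DataWord (machineArena kS nS nE) := Stream'.Seq.ofList (h.map Sum.inl ++ [Sum.inr e])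

theorem stopWord_get?_eq_inl {i : ℕ} :
    (stopWord h e).get? i = some (Sum.inl s) ↔ h[i]? = some s := by
  rw [stopWord, Stream'.Seq.ofList_get?, List.getElem?_append, List.length_map, List.getElem?_map]
  split_ifs with hi
  · simp [hi]
  · rw [List.getElem?_eq_none (by omega : h.length ≤ i)]
    rcases i - h.length with _ | n <;> simp

theorem exists_sysAt_stopWord {x : ℕ × ℕ} :
    (∃ d, (stopWord h e).SysAt d x) ↔ x ∈ h.map moveData := by
  simp only [DataWord.SysAt, DataWord.moveAt_eq_iff, stopWord_get?_eq_inl, List.mem_map]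
  constructor
  · rintro ⟨_, i, s, rfl, h1, rfl⟩
    exact ⟨s, List.mem_of_getElem? h1, rfl⟩
  · rintro ⟨s, hs, rfl⟩
    obtain ⟨i, h1⟩ := List.mem_iff_getElem?.1 hs
    exact ⟨_, ⟨i, by simp [stopWord_get?_eq_inl.2 h1]⟩, s, rfl, h1, rfl⟩

/-- The position of the last move of System. -/
def lastPos (h : List (machineArena kS nS nE).VocabS) (s : (machineArena kS nS nE).VocabS)
    (e : (machineArena kS nS nE).VocabE) : {i : ℕ // ((stopWord (h ++ [s]) e).get? i).isSome} :=
  ⟨h.length, by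
    have : (stopWord (h ++ [s]) e).get? h.length = some (Sum.inl s) := by
      rw [stopWord_get?_eq_inl]
      simp
    simp [this]⟩

theorem moveAt_lastPos : (stopWord (h ++ [s]) e).moveAt (lastPos h s e) = Sum.inl s := by
  rw [DataWord.moveAt_eq_iff, stopWord_get?_eq_inl]
  simp [lastPos]

theorem sysAt_lastPos {x : ℕ × ℕ} :
    (stopWord (h ++ [s]) e).SysAt (Sum.inl (lastPos h s e)) x ↔ moveData s = x := by
  constructor
  · rintro ⟨i, s', hi, hs', rfl⟩
    obtain rfl := Sum.inl.inj hi
    rw [moveAt_lastPos] at hs'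
    rw [Sum.inl.inj hs']
  · exact fun hx => ⟨_, s, rfl, moveAt_lastPos, hx⟩

/-- Among System positions, being different from the last one means being earlier. This replaces the
order that the logic lacks. -/
theorem exists_sysAt_ne_lastPos {x : ℕ × ℕ} :
    (∃ d, (stopWord (h ++ [s]) e).SysAt d x ∧ d ≠ Sum.inl (lastPos h s e)) ↔
      x ∈ h.map moveData := by
  simp only [DataWord.SysAt, DataWord.moveAt_eq_iff, stopWord_get?_eq_inl, List.mem_map]
  constructor
  · rintro ⟨_, ⟨i, s', rfl, h1, rfl⟩, hne⟩
    refine ⟨s', List.mem_of_getElem? (i := i.1) ?_, rfl⟩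
    have hi : i.1 ≠ h.length := fun hi => hne (congrArg Sum.inl (Subtype.ext hi))
    have := (List.getElem?_eq_some_iff.1 h1).1
    rw [List.length_append, List.length_singleton] at this
    rwa [List.getElem?_append_left (by omega)] at h1
  · rintro ⟨s', hs, rfl⟩
    obtain ⟨i, h1⟩ := List.mem_iff_getElem?.1 hs
    have hi := (List.getElem?_eq_some_iff.1 h1).1
    have h2 : (h ++ [s])[i]? = some s' := by rwa [List.getElem?_append_left hi]
    refine ⟨_, ⟨⟨i, by simp [stopWord_get?_eq_inl.2 h2]⟩, s', rfl, h2, rfl⟩, ?_⟩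
    intro heq
    have := congrArg Subtype.val (Sum.inl.inj heq)
    simp only [lastPos] at this
    omega

variable {v : Var → Option (stopWord (h ++ [s]) e).Dom}

theorem sat_sys_lastPos (hv : v 1 = some (Sum.inl (lastPos h s e))) {a : ℕ} :
    (stopWord (h ++ [s]) e).Sat (.sys a 1) v ↔ (moveData s).1 = a := by
  rw [DataWord.sat_sys hv]
  simp only [sysAt_lastPos, Prod.ext_iff]
  simp

/-- Besides earlier System positions, only the checked position and the process itself share the
process; both are exempted by the formula. The closing Environment position has a different owner.
-/
theorem sat_opCheck_inc (hv : v 1 = some (Sum.inl (lastPos h s e))) {c : Fin 3} :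
    (stopWord (h ++ [s]) e).Sat (.opCheck (.inc c)) v ↔
      (Op.inc c).OK (h.map moveData) (moveData s).2 := by
  have hlast := (sysAt_lastPos (h := h) (s := s) (e := e)).2 rfl
  have key : (stopWord (h ++ [s]) e).Sat (.opCheck (.inc c)) v ↔
      ∀ d, (stopWord (h ++ [s]) e).procOf d =
        (stopWord (h ++ [s]) e).procOf (Sum.inl (lastPos h s e)) →
        d = Sum.inl (lastPos h s e) ∨ ∃ p, d = Sum.inr (Sum.inl p) := by
    simp only [Formula.opCheck, DataWord.Sat, Function.update_self, ne_eq, one_ne_zero,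
      not_false_eq_true, Function.update_of_ne, hv, Option.some.injEq, exists_and_left,
      exists_eq_left', imp_iff_not_or]
  rw [key, Op.OK]
  constructor
  · intro H a ha
    obtain ⟨d, hd, hne⟩ := exists_sysAt_ne_lastPos.2 ha
    rcases H d ((hd.procOf_eq_iff hlast).2 rfl) with rfl | ⟨p, rfl⟩
    · exact hne rfl
    · obtain ⟨i, s', hi, -⟩ := hd
      simp at hi
  · intro H d hd
    by_contra hcon
    push Not at hcon
    rcases d with i | p
    · rcases hi : (stopWord (h ++ [s]) e).moveAt i with s' | ⟨e', p | p⟩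
      · have hd' : (stopWord (h ++ [s]) e).SysAt (Sum.inl i) (moveData s') := ⟨i, s', rfl, hi, rfl⟩
        refine H (moveData s').1 ?_
        rw [← (hd'.procOf_eq_iff hlast).1 hd]
        exact exists_sysAt_ne_lastPos.1 ⟨_, hd', hcon.1⟩
      · obtain ⟨a, p' | p'⟩ := s
        · simp [DataWord.procOf, hi, moveAt_lastPos, Arena.proc] at hd
        · exact p'.elim0
      · exact p.elim0
    · obtain ⟨a, p' | p'⟩ := s
      · simp only [DataWord.procOf, moveAt_lastPos, Arena.proc] at hd
        exact hcon.2 p' (congrArg Sum.inr hd)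
      · exact p'.elim0

theorem exists_sim_lastPos {a : ℕ} {Q : (stopWord (h ++ [s]) e).Dom → Prop} :
    (∃ d, (stopWord (h ++ [s]) e).procOf d =
        (stopWord (h ++ [s]) e).procOf (Sum.inl (lastPos h s e)) ∧
      (∃ p, (stopWord (h ++ [s]) e).SysAt d (a, p)) ∧ Q d) ↔
    ∃ d, (stopWord (h ++ [s]) e).SysAt d (a, (moveData s).2) ∧ Q d := by
  have hlast := (sysAt_lastPos (h := h) (s := s) (e := e)).2 rfl
  refine exists_congr fun d => ⟨?_, ?_⟩
  · rintro ⟨hd, ⟨p, hp⟩, hQ⟩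
    obtain rfl := (hp.procOf_eq_iff hlast).1 hd
    exact ⟨hp, hQ⟩
  · rintro ⟨hp, hQ⟩
    exact ⟨(hp.procOf_eq_iff hlast).2 rfl, ⟨_, hp⟩, hQ⟩

/-- The checked position must be excluded from the search for an earlier decrement, but not from the
search for an increment, since its own letter is a decrement. -/
theorem sat_opCheck_dec (hv : v 1 = some (Sum.inl (lastPos h s e))) {c : Fin 3}
    (hs : (moveData s).1 = (Op.dec c).letter) :
    (stopWord (h ++ [s]) e).Sat (.opCheck (.dec c)) v ↔
      (Op.dec c).OK (h.map moveData) (moveData s).2 := by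
  have key : (stopWord (h ++ [s]) e).Sat (.opCheck (.dec c)) v ↔
      (∃ d, (stopWord (h ++ [s]) e).procOf d =
        (stopWord (h ++ [s]) e).procOf (Sum.inl (lastPos h s e)) ∧
        (∃ p, (stopWord (h ++ [s]) e).SysAt d ((Op.inc c).letter, p)) ∧ True) ∧
      ¬ ∃ d, (stopWord (h ++ [s]) e).procOf d =
        (stopWord (h ++ [s]) e).procOf (Sum.inl (lastPos h s e)) ∧
        (∃ p, (stopWord (h ++ [s]) e).SysAt d ((Op.dec c).letter, p)) ∧
        d ≠ Sum.inl (lastPos h s e) := by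
    simp only [Formula.opCheck, DataWord.Sat]
    refine and_congr (exists_congr fun d => ?_) (not_congr (exists_congr fun d => ?_))
    · rw [DataWord.sat_sys (d := d) (by simp)]
      simp [hv]
    · rw [DataWord.sat_sys (d := d) (by simp)]
      simp only [Function.update_self, ne_eq, one_ne_zero, not_false_eq_true,
        Function.update_of_ne, hv, Option.some.injEq, exists_and_left, exists_eq_left', and_assoc]
  rw [key, exists_sim_lastPos, exists_sim_lastPos, exists_sysAt_ne_lastPos, Op.OK, mem_activeData]
  simp only [and_true]
  rw [exists_sysAt_stopWord, List.map_append, List.mem_append]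
  have : ((Op.inc c).letter, (moveData s).2) ∉ [s].map moveData := by
    simp [Prod.ext_iff, hs, Op.letter_injective.eq_iff]
  rw [or_iff_left this]

/-- The checked position carries neither an increment nor a decrement letter, so the condition may
range over the whole word; variable 1 is free to be requantified. -/
theorem sat_opCheck_zero {c : Fin 3}
    (hs : (moveData s).1 = (Op.zero c).letter) :
    (stopWord (h ++ [s]) e).Sat (.opCheck (.zero c)) v ↔
      (Op.zero c).OK (h.map moveData) (moveData s).2 := by
  have key : (stopWord (h ++ [s]) e).Sat (.opCheck (.zero c)) v ↔
      ¬ ∃ d, (∃ p, (stopWord (h ++ [s]) e).SysAt d ((Op.inc c).letter, p)) ∧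
        ¬ ∃ d', (stopWord (h ++ [s]) e).procOf d = (stopWord (h ++ [s]) e).procOf d' ∧
          ∃ p, (stopWord (h ++ [s]) e).SysAt d' ((Op.dec c).letter, p) := by
    simp only [Formula.opCheck, DataWord.Sat]
    refine not_congr (exists_congr fun d => and_congr ?_ (not_congr (exists_congr fun d' => ?_)))
    · rw [DataWord.sat_sys (d := d) (by simp)]
    · rw [DataWord.sat_sys (d := d') (by simp)]
      simp
  have hmem : ∀ (o : Op) p, o ≠ .zero c →
      ((o.letter, p) ∈ h.map moveData ↔ ∃ d, (stopWord (h ++ [s]) e).SysAt d (o.letter, p)) := by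
    intro o p ho
    rw [exists_sysAt_stopWord, List.map_append, List.mem_append, iff_self_or]
    intro hm
    have := congrArg Prod.fst (List.mem_singleton.1 hm)
    exact absurd (Op.letter_injective (this.trans hs)) ho
  rw [key, Op.OK, Finset.eq_empty_iff_forall_notMem, not_exists]
  simp only [mem_activeData]
  constructor
  · rintro H p ⟨h1, h2⟩
    obtain ⟨d, hd⟩ := (hmem _ _ (by simp)).1 h1
    refine H d ⟨⟨p, hd⟩, ?_⟩
    rintro ⟨d', h3, p', hp'⟩
    obtain rfl : p = p' := (hd.procOf_eq_iff hp').1 h3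
    exact h2 ((hmem _ _ (by simp)).2 ⟨d', hp'⟩)
  · rintro H d ⟨⟨p, hd⟩, h2⟩
    refine H p ⟨(hmem _ _ (by simp)).2 ⟨d, hd⟩, fun h3 => h2 ?_⟩
    obtain ⟨d', hd'⟩ := (hmem _ _ (by simp)).1 h3
    exact ⟨d', (hd.procOf_eq_iff hd').2 rfl, p, hd'⟩

theorem sat_opFormula (hv : v 1 = some (Sum.inl (lastPos h s e))) {o : Op} :
    (stopWord (h ++ [s]) e).Sat (.opFormula o) v ↔
      (moveData s).1 = o.letter ∧ o.OK (h.map moveData) (moveData s).2 := by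
  rw [Formula.opFormula, DataWord.Sat, sat_sys_lastPos hv]
  refine and_congr_right fun hs => ?_
  cases o with
  | inc c => exact sat_opCheck_inc hv
  | dec c => exact sat_opCheck_dec hv hs
  | zero c => exact sat_opCheck_zero hs

theorem sat_startFormula (hv : v 1 = some (Sum.inl (lastPos h s e))) {q : ℕ} :
    (stopWord (h ++ [s]) e).Sat (.startFormula q) v ↔
      (moveData s).1 = stateLetter q ∧ h.map moveData = [] := by
  rw [Formula.startFormula, DataWord.Sat, sat_sys_lastPos hv]
  refine and_congr_right fun _ => ?_
  simp only [DataWord.Sat, Function.update_self, ne_eq, one_ne_zero, not_false_eq_true,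
    Function.update_of_ne, hv, Option.some.injEq, exists_and_left, exists_eq_left',
    List.map_eq_nil_iff]
  constructor
  · intro H
    by_contra hne
    have hpos := List.length_pos_iff.2 hne
    refine H ⟨Sum.inl ⟨h.length - 1, ?_⟩, ?_⟩
    · rw [stopWord_get?_eq_inl.2 (List.getElem?_eq_getElem
        (by simp only [List.length_append]; omega))]
      rfl
    · simp only [DataWord.IsSucc, lastPos]
      omega
  · rintro rfl ⟨d, hd⟩
    obtain ⟨j, -, hj⟩ := DataWord.isSucc_inl_iff.1 hd
    simp [lastPos] at hj

theorem eq_append_pair_iff {α : Type*} {l : List α} {x y : α} :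
    (∃ l', l = l' ++ [x, y]) ↔ ∃ i, l.length = i + 2 ∧ l[i]? = some x ∧ l[i + 1]? = some y := by
  constructor
  · rintro ⟨l', rfl⟩
    exact ⟨l'.length, by simp, by simp, by simp⟩
  · rintro ⟨i, hl, hx, hy⟩
    refine ⟨l.take i, List.ext_getElem? fun j => ?_⟩
    rw [List.getElem?_append, List.length_take, List.getElem?_take]
    obtain hj | hj | hj | hj : j < i ∨ j = i ∨ j = i + 1 ∨ i + 2 ≤ j := by omega
    · rw [if_pos (by omega), if_pos hj]
    · subst hj
      rw [if_neg (by omega), hx, (by omega : j - min j l.length = 0)]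
      rfl
    · subst hj
      rw [if_neg (by omega), hy, (by omega : i + 1 - min i l.length = 1)]
      rfl
    · rw [if_neg (by omega), List.getElem?_eq_none (by omega), List.getElem?_eq_none]
      simp only [List.length_cons, List.length_nil]
      omega

/-- Three consecutive positions are inspected with two variables by reusing variable 1 once variable
0 holds the predecessor. -/
theorem sat_ruleFormula (hv : v 1 = some (Sum.inl (lastPos h s e))) {r : Rule} :
    (stopWord (h ++ [s]) e).Sat (.ruleFormula r) v ↔
      (moveData s).1 = stateLetter r.2.2 ∧ ∃ h' p₁ p₂,
        h.map moveData = h' ++ [(stateLetter r.1, p₁), (r.2.1.letter, p₂)] := by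
  rw [Formula.ruleFormula, DataWord.Sat, sat_sys_lastPos hv]
  refine and_congr_right fun _ => ?_
  have key : (stopWord (h ++ [s]) e).Sat (.ex 0 (.and (.and (.succ 1 0) (.sys r.2.1.letter 0))
      (.ex 1 (.and (.succ 0 1) (.sys (stateLetter r.1) 1))))) v ↔
      ∃ d, ((stopWord (h ++ [s]) e).IsSucc (Sum.inl (lastPos h s e)) d ∧
        ∃ p, (stopWord (h ++ [s]) e).SysAt d (r.2.1.letter, p)) ∧
        ∃ d', (stopWord (h ++ [s]) e).IsSucc d d' ∧
        ∃ p, (stopWord (h ++ [s]) e).SysAt d' (stateLetter r.1, p) := by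
    simp only [DataWord.Sat]
    refine exists_congr fun d => and_congr (and_congr ?_ ?_) (exists_congr fun d' =>
      and_congr ?_ ?_)
    · simp [hv]
    · rw [DataWord.sat_sys (d := d) (by simp)]
    · simp
    · rw [DataWord.sat_sys (d := d') (by simp)]
  rw [key]
  have h3 : (∃ h' p₁ p₂, h.map moveData = h' ++ [(stateLetter r.1, p₁), (r.2.1.letter, p₂)]) ↔
      ∃ p₁ p₂ i, (h.map moveData).length = i + 2 ∧
        (h.map moveData)[i]? = some (stateLetter r.1, p₁) ∧
        (h.map moveData)[i + 1]? = some (r.2.1.letter, p₂) := by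
    simp only [← eq_append_pair_iff]
    constructor
    · rintro ⟨h', p₁, p₂, H⟩
      exact ⟨p₁, p₂, h', H⟩
    · rintro ⟨p₁, p₂, h', H⟩
      exact ⟨h', p₁, p₂, H⟩
  rw [h3]
  simp only [List.length_map, List.getElem?_map, Option.map_eq_some_iff]
  constructor
  · rintro ⟨d, ⟨hd, p₂, ⟨j, s₂, rfl, hj, hs₂⟩⟩, d', hd', p₁, ⟨i, s₁, rfl, hi, hs₁⟩⟩
    obtain ⟨-, h4⟩ : _ ∧ h.length = j.1 + 1 := ⟨trivial, hd⟩
    obtain ⟨-, h5⟩ : _ ∧ j.1 = i.1 + 1 := ⟨trivial, hd'⟩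
    rw [DataWord.moveAt_eq_iff, stopWord_get?_eq_inl, List.getElem?_append_left (by omega)] at hi hj
    refine ⟨p₁, p₂, i.1, by omega, ⟨s₁, hi, hs₁⟩, ⟨s₂, ?_, hs₂⟩⟩
    rwa [← h5]
  · rintro ⟨p₁, p₂, i, h4, ⟨s₁, hi, hs₁⟩, ⟨s₂, hj, hs₂⟩⟩
    rw [← List.getElem?_append_left (l₂ := [s]) (by omega), ← stopWord_get?_eq_inl (e := e)]
      at hi hj
    exact ⟨Sum.inl ⟨i + 1, by simp [hj]⟩, ⟨h4, p₂, _, s₂, rfl, DataWord.moveAt_eq_iff.2 hj, hs₂⟩,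
      Sum.inl ⟨i, by simp [hi]⟩, rfl, p₁, _, s₁, rfl, DataWord.moveAt_eq_iff.2 hi, hs₁⟩

theorem sat_extFormula (hv : v 1 = some (Sum.inl (lastPos h s e))) {q : ℕ} {Δ : List Rule} :
    (stopWord (h ++ [s]) e).Sat (.extFormula q Δ) v ↔
      ExtOK Δ q (h.map moveData) (moveData s) := by
  simp only [Formula.extFormula, DataWord.Sat, DataWord.sat_disj, List.mem_map, ExtOK]
  refine or_congr (sat_startFormula hv) (or_congr ?_ ?_)
  · constructor
    · rintro ⟨_, ⟨o, -, rfl⟩, H⟩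
      exact ⟨o, (sat_opFormula hv).1 H⟩
    · rintro ⟨o, H⟩
      exact ⟨_, ⟨o, o.mem_list, rfl⟩, (sat_opFormula hv).2 H⟩
  · constructor
    · rintro ⟨_, ⟨r, hr, rfl⟩, H⟩
      exact ⟨r, hr, (sat_ruleFormula hv).1 H⟩
    · rintro ⟨r, hr, H⟩
      exact ⟨_, ⟨r, hr, rfl⟩, (sat_ruleFormula hv).2 H⟩

end LastMove

/-! ### Sequences and their finite prefixes -/

section Seq

variable {α β γ : Type*}

open Stream' (Seq)

theorem seq_length_take {w : Seq α} {n : ℕ} (h : (w.get? n).isSome) : (w.take n).length = n := by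
  refine le_antisymm Seq.length_take_le (not_lt.1 fun hlt => ?_)
  have h1 := List.getElem?_eq_none (le_refl (w.take n).length)
  rw [Seq.getElem?_take, if_pos hlt] at h1
  rw [w.le_stable hlt.le h1] at h
  simp at h

theorem seq_take_add_one (w : Seq α) (n : ℕ) :
    w.take (n + 1) = w.take n ++ (w.get? n).toList := by
  refine List.ext_getElem? fun i => ?_
  rcases h : w.get? n with _ | x
  · simp only [Option.toList_none, List.append_nil, Seq.getElem?_take]
    obtain hi | rfl | hi : i < n ∨ i = n ∨ n < i := by omega
    · rw [if_pos (by omega), if_pos hi]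
    · rw [if_pos (by omega), if_neg (by omega), h]
    · rw [if_neg (by omega), if_neg (by omega)]
  · have hl : (w.take n).length = n := seq_length_take (by simp [h])
    rw [List.getElem?_append, hl, Seq.getElem?_take, Seq.getElem?_take]
    obtain hi | rfl | hi : i < n ∨ i = n ∨ n < i := by omega
    · rw [if_pos (by omega), if_pos hi, if_pos hi]
    · simp [h]
    · rw [if_neg (by omega), if_neg (by omega), List.getElem?_eq_none]
      simp only [Option.toList_some, List.length_singleton]
      omega

theorem seq_take_take (w : Seq α) {m n : ℕ} (h : m ≤ n) : (w.take n).take m = w.take m := by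
  refine List.ext_getElem? fun i => ?_
  rw [List.getElem?_take, Seq.getElem?_take, Seq.getElem?_take]
  split_ifs <;> first | rfl | omega

theorem seq_toList_eq_take {w : Seq α} {n : ℕ} (h : w.get? n = none) (ht : w.Terminates) :
    w.toList ht = w.take n := by
  refine List.ext_getElem? fun i => ?_
  rw [Seq.getElem?_toList, Seq.getElem?_take]
  split_ifs with hi
  · rfl
  · exact w.le_stable (not_lt.1 hi) h

/-- A sequence in which each element is determined by the elements before it. -/
theorem exists_seq_of_next (next : List α → Option α) :
    ∃ w : Seq α, ∀ n, w.get? n = next (w.take n) := by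
  let pre : ℕ → List α := fun n => Nat.rec [] (fun _ l => l ++ (next l).toList) n
  have hpre : ∀ n, pre (n + 1) = pre n ++ (next (pre n)).toList := fun _ => rfl
  let w : Seq α := ⟨fun n => next (pre n), @fun n hn => by
    have hn' : next (pre n) = none := hn
    change next (pre (n + 1)) = none
    rw [hpre, hn']
    simpa using hn'⟩
  have hw : ∀ n, w.get? n = next (pre n) := fun _ => rfl
  refine ⟨w, fun n => ?_⟩
  have : w.take n = pre n := by
    induction n with
    | zero => rfl
    | succ n ih => rw [seq_take_add_one, ih, hw, hpre]
  rw [hw, this]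

theorem exists_eq_map_of_forall {f : α → β} {l : List β} (h : ∀ x ∈ l, ∃ y, f y = x) :
    ∃ u : List α, l = u.map f := by
  induction l with
  | nil => exact ⟨[], rfl⟩
  | cons x l ih =>
    obtain ⟨y, rfl⟩ := h x (by simp)
    obtain ⟨u, rfl⟩ := ih fun z hz => h z (by simp [hz])
    exact ⟨y :: u, rfl⟩

theorem exists_take_eq_map_inl {w : Seq (α ⊕ β)} {n : ℕ}
    (h : ∀ k < n, ∀ e, w.get? k ≠ some (Sum.inr e)) :
    ∃ u : List α, w.take n = u.map Sum.inl := by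
  refine exists_eq_map_of_forall fun x hx => ?_
  obtain ⟨i, hi⟩ := List.mem_iff_getElem?.1 hx
  rw [Seq.getElem?_take] at hi
  split_ifs at hi with hin
  rcases x with s | e
  · exact ⟨s, rfl⟩
  · exact absurd hi (h i hin e)

end Seq

/-! ### The models of the formula -/

variable {kS nS nE : ℕ}

theorem stopWord_get?_length {h : List (machineArena kS nS nE).VocabS}
    {e : (machineArena kS nS nE).VocabE} : (stopWord h e).get? h.length = some (Sum.inr e) := by
  rw [stopWord, Stream'.Seq.ofList_get?]
  simp

theorem stopWord_get?_length_add_one {h : List (machineArena kS nS nE).VocabS}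
    {e : (machineArena kS nS nE).VocabE} : (stopWord h e).get? (h.length + 1) = none := by
  rw [stopWord, Stream'.Seq.ofList_get?]
  simp

theorem eq_stopWord {w : DataWord (machineArena kS nS nE)} {h : List (machineArena kS nS nE).VocabS}
    {e : (machineArena kS nS nE).VocabE} {i : ℕ} (h1 : w.take i = h.map Sum.inl)
    (h2 : w.get? i = some (Sum.inr e)) (h3 : w.get? (i + 1) = none) : w = stopWord h e := by
  have hl : h.length = i := by
    rw [← seq_length_take (w := w) (n := i) (by simp [h2]), h1, List.length_map]
  refine Stream'.Seq.ext fun n => ?_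
  rw [stopWord, Stream'.Seq.ofList_get?, List.getElem?_append, List.length_map, hl, ← h1,
    Stream'.Seq.getElem?_take]
  obtain hi | rfl | hi : n < i ∨ n = i ∨ i + 1 ≤ n := by omega
  · rw [if_pos hi, if_pos hi]
  · simp [h2]
  · rw [if_neg (by omega), List.getElem?_eq_none, w.le_stable hi h3]
    simp only [List.length_singleton]
    omega

theorem envAt_inl_iff {w : DataWord (machineArena kS nS nE)}
    {i : {i : ℕ // (w.get? i).isSome}} :
    w.EnvAt (Sum.inl i) ↔ ∃ e, w.get? i.1 = some (Sum.inr e) := by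
  simp only [DataWord.EnvAt, ← DataWord.moveAt_eq_iff]
  constructor
  · rintro ⟨j, e, hj, he⟩
    obtain rfl := Sum.inl.inj hj
    exact ⟨e, he⟩
  · rintro ⟨e, he⟩
    exact ⟨i, e, rfl, he⟩

theorem exists_of_envAt {w : DataWord (machineArena kS nS nE)} {d : w.Dom} (h : w.EnvAt d) :
    ∃ i : {i : ℕ // (w.get? i).isSome}, d = Sum.inl i ∧ ∃ e, w.get? i.1 = some (Sum.inr e) := by
  obtain ⟨i, e, rfl, he⟩ := h
  exact ⟨i, rfl, e, DataWord.moveAt_eq_iff.1 he⟩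

/-- The positions of Environment's moves. -/
def EnvIndex (w : DataWord (machineArena kS nS nE)) (i : ℕ) : Prop :=
  ∃ e, w.get? i = some (Sum.inr e)

/-- This translates the winning condition into words, so that the game argument need not mention
formulas. For `h = []` the last alternative is vacuous: a lone challenge before any System move is
lost by Environment. -/
theorem models_machineFormula_iff {w : DataWord (machineArena kS nS nE)} {s f : ℕ}
    {Δ : List Rule} : w.Models (.machineFormula s Δ f) ↔ 0 < nE ∧
      ((∃ i j, i ≠ j ∧ EnvIndex w i ∧ EnvIndex w j) ∨
        ((∀ i, ¬ EnvIndex w i) ∧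
          ∃ i m, w.get? i = some (Sum.inl m) ∧ (moveData m).1 = stateLetter f) ∨
        ∃ h e, w = stopWord h e ∧ ∀ h' m, h = h' ++ [m] →
          ExtOK Δ s (h'.map moveData) (moveData m)) := by
  have h1 : w.Sat (.ex 0 (.procE 0)) (fun _ => none) ↔ 0 < nE := by
    simp only [DataWord.Sat, Function.update_self, Option.some.injEq]
    constructor
    · rintro ⟨_, p, -⟩
      exact p.pos
    · exact fun h => ⟨_, ⟨0, h⟩, rfl⟩
  have h2 : w.Sat .twoEnv (fun _ => none) ↔ ∃ i j, i ≠ j ∧ EnvIndex w i ∧ EnvIndex w j := by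
    rw [DataWord.sat_twoEnv]
    constructor
    · rintro ⟨d, d', hd, hd', hne⟩
      obtain ⟨i, rfl, hi⟩ := exists_of_envAt hd
      obtain ⟨j, rfl, hj⟩ := exists_of_envAt hd'
      exact ⟨i, j, fun h => hne (congrArg Sum.inl (Subtype.ext h)), hi, hj⟩
    · rintro ⟨i, j, hne, ⟨e, hi⟩, ⟨e', hj⟩⟩
      exact ⟨Sum.inl ⟨i, by simp [hi]⟩, Sum.inl ⟨j, by simp [hj]⟩, envAt_inl_iff.2 ⟨e, hi⟩,
        envAt_inl_iff.2 ⟨e', hj⟩, fun h => hne (congrArg Subtype.val (Sum.inl.inj h))⟩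
  have h3 : w.Sat .noEnv (fun _ => none) ↔ ∀ i, ¬ EnvIndex w i := by
    rw [DataWord.sat_noEnv]
    constructor
    · rintro H i ⟨e, hi⟩
      exact H (Sum.inl ⟨i, by simp [hi]⟩) (envAt_inl_iff.2 ⟨e, hi⟩)
    · intro H d hd
      obtain ⟨i, rfl, hi⟩ := exists_of_envAt hd
      exact H _ hi
  have h4 : w.Sat (.ex 0 (.sys (stateLetter f) 0)) (fun _ => none) ↔
      ∃ i m, w.get? i = some (Sum.inl m) ∧ (moveData m).1 = stateLetter f := by
    have : w.Sat (.ex 0 (.sys (stateLetter f) 0)) (fun _ => none) ↔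
        ∃ d p, w.SysAt d (stateLetter f, p) := by
      simp only [DataWord.Sat]
      refine exists_congr fun d => ?_
      rw [DataWord.sat_sys (d := d) (by simp)]
    rw [this]
    constructor
    · rintro ⟨d, p, i, m, -, hm, hp⟩
      exact ⟨i, m, DataWord.moveAt_eq_iff.1 hm, by rw [hp]⟩
    · rintro ⟨i, m, hm, hf⟩
      exact ⟨Sum.inl ⟨i, by simp [hm]⟩, _, _, m, rfl, DataWord.moveAt_eq_iff.2 hm,
        Prod.ext hf rfl⟩
  rw [DataWord.Models, Formula.machineFormula]
  simp only [DataWord.Sat] at h1 h4 ⊢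
  rw [h1, h2, h3, h4]
  -- The last alternatives are compared only when there are no two Environment moves: `lastEnv` by
  -- itself does not make the preceding moves System moves.
  refine and_congr_right fun _ => or_congr_right' fun hone => or_congr_right ?_
  rw [DataWord.sat_lastEnv]
  constructor
  · rintro ⟨d, hd, hlast, hsat⟩
    obtain ⟨i, rfl, e, he⟩ := exists_of_envAt hd
    obtain ⟨u, hu⟩ := exists_take_eq_map_inl (w := w) (n := i.1) fun k hk e' he' =>
      hone ⟨k, i.1, hk.ne, ⟨e', he'⟩, ⟨e, he⟩⟩
    have hnone : w.get? (i.1 + 1) = none := by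
      by_contra hne
      exact hlast (Sum.inl ⟨i.1 + 1, Option.isSome_iff_ne_none.2 hne⟩) rfl
    obtain rfl := eq_stopWord hu he hnone
    refine ⟨u, e, rfl, ?_⟩
    rintro h' m rfl
    refine (sat_extFormula (h := h') (s := m) (e := e) ?_).1 (hsat (Sum.inl (lastPos h' m e)) ?_)
    · simp
    · have : i.1 = (h' ++ [m]).length := by
        rw [← seq_length_take i.2, hu, List.length_map]
      simpa [DataWord.IsSucc, lastPos] using this
  · rintro ⟨h, e, rfl, hext⟩
    have he := stopWord_get?_length (h := h) (e := e)
    refine ⟨Sum.inl ⟨h.length, by simp [he]⟩, envAt_inl_iff.2 ⟨e, he⟩, ?_, ?_⟩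
    · rintro (⟨j, hj⟩ | p) hs
      · obtain rfl : j = h.length + 1 := hs
        simp [stopWord_get?_length_add_one] at hj
      · exact hs
    · intro d' hd'
      obtain ⟨j, rfl, hj⟩ := DataWord.isSucc_inl_iff.1 hd'
      obtain rfl | ⟨h', m, rfl⟩ := List.eq_nil_or_concat' h
      · simp at hj
      · refine (sat_extFormula (h := h') (s := m) (e := e) ?_).2 (hext h' m rfl)
        simp only [Function.update_self, lastPos, Option.some.injEq, Sum.inl.injEq]
        refine Subtype.ext ?_
        simp only [List.length_append, List.length_singleton] at hj
        simp only
        omega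

/-! ### Winning strategies simulate the machine -/

/-- A history that follows the strategy can be continued, without moves of Environment, to a fair
compatible word. -/
theorem exists_continuation {A : Arena} (S : Strategy A) (h : List A.Vocab)
    (hh : ∀ i s, h[i]? = some (Sum.inl s) → S (h.take i) = some s) :
    ∃ w : DataWord A, S.Compatible w ∧ S.Fair w ∧ w.take h.length = h ∧
      ∀ i e, h.length ≤ i → w.get? i ≠ some (Sum.inr e) := by
  -- Copy `h`, then follow the strategy alone, ending where it passes.
  obtain ⟨w, hw⟩ := exists_seq_of_next fun l : List A.Vocab =>
    if l.length < h.length then h[l.length]? else (S l).map Sum.inl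
  have hlen : ∀ i, (w.get? i).isSome → (w.take i).length = i := fun i => seq_length_take
  have htake : ∀ i ≤ h.length, w.take i = h.take i := by
    intro i
    induction i with
    | zero => intro _; simp
    | succ i ih =>
      intro hi
      have hl : (w.take i).length = i := by
        rw [ih (by omega), List.length_take]
        omega
      rw [seq_take_add_one, List.take_add_one, ih (by omega), hw, hl, if_pos (by omega)]
  have hafter : ∀ i, h.length ≤ i → (w.get? i).isSome →
      w.get? i = (S (w.take i)).map Sum.inl := by
    intro i hi hs
    rw [hw, if_neg]
    rw [hlen i hs]
    omega
  have henv : ∀ i e, h.length ≤ i → w.get? i ≠ some (Sum.inr e) := by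
    intro i e hi he
    rw [hafter i hi (by simp [he])] at he
    simp at he
  refine ⟨w, ⟨?_, ?_⟩, ?_, by rw [htake _ le_rfl, List.take_length], henv⟩
  · intro i s hi
    obtain hlt | hle := lt_or_ge i h.length
    · rw [htake i hlt.le]
      refine hh i s ?_
      have hsome : (w.get? i).isSome := by simp [hi]
      rw [hw, hlen i hsome, if_pos hlt] at hi
      exact hi
    · rw [hafter i hle (by simp [hi])] at hi
      simpa using hi
  · intro ht
    obtain ⟨n, hn⟩ := id ht
    change w.get? n = none at hn
    rw [seq_toList_eq_take hn ht]
    rw [hw] at hn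
    split_ifs at hn with hlt
    · rw [List.getElem?_eq_none_iff] at hn
      omega
    · simpa using hn
  -- Past `h` every position is a System move, so finitely many System moves leave only finitely
  -- many positions.
  · intro hinf hfin
    refine hinf ((hfin.union (Set.finite_Iio h.length)).subset ?_)
    rintro i ⟨hi, -⟩
    obtain hlt | hle := lt_or_ge i h.length
    · exact Or.inr hlt
    · obtain ⟨m, hm⟩ := Option.isSome_iff_exists.1 hi
      rcases m with s | e
      · exact Or.inl ⟨s, hm⟩
      · exact absurd hm (henv i e hle)

/-- The play without Environment must reach the final state. After any of its moves Environment may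
interject once; up to there the strategy has seen the same history, so winning against the
interjection shows that this move was correct. -/
theorem exists_allOK_of_winning {S : Strategy (machineArena kS nS nE)} {s f : ℕ} {Δ : List Rule}
    (H : S.Winning (.machineFormula s Δ f)) : ∃ h p, AllOK Δ s (h ++ [(stateLetter f, p)]) := by
  obtain ⟨w, hc, hf, -, henv⟩ := exists_continuation S [] (by simp)
  replace henv : ∀ i e, w.get? i ≠ some (Sum.inr e) := fun i e => henv i e (Nat.zero_le _)
  obtain ⟨hE, ⟨i, -, -, ⟨e, he⟩, -⟩ | ⟨-, n, m, hn, hm⟩ | ⟨h, e, rfl, -⟩⟩ :=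
    models_machineFormula_iff.1 (H w hc hf)
  · exact absurd he (henv i e)
  · have key : ∀ (j : ℕ) (u : List (machineArena kS nS nE).VocabS), w.take j = u.map Sum.inl →
        AllOK Δ s (u.map moveData) := by
      intro j
      induction j with
      | zero =>
        intro u hu
        obtain rfl : u = [] := by simpa using hu.symm
        exact .nil
      | succ j ih =>
        intro u hu
        rw [seq_take_add_one] at hu
        rcases hj : w.get? j with _ | x | e
        · rw [hj] at hu
          exact ih u (by simpa using hu)
        · obtain ⟨u', hu'⟩ := exists_take_eq_map_inl (w := w) (n := j) fun k _ e => henv k e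
          have hl : u'.length = j := by
            rw [← seq_length_take (w := w) (n := j) (by simp [hj]), hu', List.length_map]
          obtain rfl : u = u' ++ [x] := by
            refine List.map_injective_iff.2
              (Sum.inl_injective (β := (machineArena kS nS nE).VocabE)) ?_
            rw [← hu, hu', hj]
            simp
          rw [List.map_append]
          refine .snoc _ _ (ih u' hu') ?_
          -- A challenge exists because the formula demands an Environment process.
          let e : (machineArena kS nS nE).VocabE := (0, Sum.inl ⟨0, hE⟩)
          have hw1 : w.take (j + 1) = (u' ++ [x]).map Sum.inl := by rw [seq_take_add_one, hu]
          obtain ⟨w', hc', hf', htake', henv'⟩ := exists_continuation S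
            ((u' ++ [x]).map Sum.inl ++ [Sum.inr e]) (by
              intro i y hi
              have hi' : i < j + 1 := by
                by_contra hcon
                rw [List.getElem?_append_right (by simp [hl]; omega)] at hi
                have := List.mem_singleton.1 (List.mem_of_getElem? hi)
                simp at this
              rw [List.getElem?_append_left (by simpa [hl] using hi'), ← hw1,
                Stream'.Seq.getElem?_take, if_pos hi'] at hi
              rw [List.take_append_of_le_length (by simp [hl]; omega), ← hw1,
                seq_take_take _ (by omega)]
              exact hc.1 i y hi)
          have hlen :
              ((u' ++ [x]).map Sum.inl ++ [(Sum.inr e : (machineArena kS nS nE).Vocab)]).length =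
                j + 2 := by simp [hl]
          have hget : ∀ i < j + 2, w'.get? i =
              ((u' ++ [x]).map Sum.inl ++ [(Sum.inr e : (machineArena kS nS nE).Vocab)])[i]? := by
            intro i hi
            rw [← htake', hlen, Stream'.Seq.getElem?_take, if_pos hi]
          have hej : w'.get? (j + 1) = some (Sum.inr e) := by
            rw [hget _ (by omega), List.getElem?_append_right (by simp [hl])]
            simp [hl]
          -- The challenge is the only Environment move: before it stands the old play, after it
          -- only the strategy. This leaves just the `stopWord` alternative.
          have huniq : ∀ i, EnvIndex w' i → i = j + 1 := by
            rintro i ⟨e', hi⟩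
            by_contra hne
            obtain hlt | hge : i < j + 1 ∨ j + 2 ≤ i := by omega
            · rw [hget _ (by omega), List.getElem?_append_left (by simpa [hl] using hlt)] at hi
              obtain ⟨_, -, h⟩ := List.mem_map.1 (List.mem_of_getElem? hi)
              exact absurd h (by simp)
            · exact henv' i e' (hlen ▸ hge) hi
          obtain ⟨-, ⟨i₁, i₂, hne, h1, h2⟩ | ⟨hno, -⟩ | ⟨h, e', rfl, hext⟩⟩ :=
            models_machineFormula_iff.1 (H w' hc' hf')
          · exact absurd ((huniq _ h1).trans (huniq _ h2).symm) hne
          · exact absurd ⟨e, hej⟩ (hno (j + 1))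
          · refine hext u' x ?_
            have hh : h.length = j + 1 := huniq _ ⟨e', stopWord_get?_length⟩
            refine List.map_injective_iff.2
              (Sum.inl_injective (β := (machineArena kS nS nE).VocabE)) ?_
            refine List.ext_getElem? fun i => ?_
            obtain hi | hi := lt_or_ge i (j + 1)
            · have := hget i (by omega)
              rwa [stopWord, Stream'.Seq.ofList_get?, List.getElem?_append_left (by simp; omega),
                List.getElem?_append_left (by simp; omega)] at this
            · rw [List.getElem?_eq_none (by simp; omega), List.getElem?_eq_none (by simp; omega)]
        · exact absurd hj (henv j e)
    obtain ⟨u, hu⟩ := exists_take_eq_map_inl (w := w) (n := n) fun k _ e => henv k e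
    have := key (n + 1) (u ++ [m]) (by rw [seq_take_add_one, hu, hn]; simp)
    rw [List.map_append] at this
    refine ⟨u.map moveData, (moveData m).2, ?_⟩
    rw [← hm]
    exact this
  · exact absurd stopWord_get?_length (henv h.length e)

/-! ### A halting machine gives a winning strategy -/

theorem AllOK.of_append {Δ : List Rule} {s : ℕ} {h h' : List (ℕ × ℕ)} (H : AllOK Δ s (h ++ h')) :
    AllOK Δ s h := by
  induction h' using List.reverseRecOn with
  | nil => simpa using H
  | append_singleton h' x ih =>
    rw [← List.append_assoc] at H
    exact ih (allOK_append_singleton.1 H).1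

open Classical in
/-- The strategy that plays a given list of moves unless Environment moves. -/
noncomputable def playList {A : Arena} (u : List A.VocabS) : Strategy A := fun l =>
  if l = (u.take l.length).map Sum.inl then u[l.length]? else none

theorem playList_eq_of_eq {A : Arena} {u : List A.VocabS} {l : List A.Vocab} {i : ℕ}
    (h : l = (u.take i).map Sum.inl) : playList u l = u[i]? := by
  have hl : l.length = min i u.length := by simp [h]
  have ht : u.take (min i u.length) = u.take i := by
    obtain hi | hi := le_total i u.length
    · rw [min_eq_left hi]
    · rw [min_eq_right hi, List.take_length, List.take_of_length_le hi]
  rw [playList, hl, ht, if_pos h]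
  obtain hi | hi := le_total i u.length
  · rw [min_eq_left hi]
  · rw [min_eq_right hi, List.getElem?_eq_none le_rfl, List.getElem?_eq_none hi]

/-- A compatible word may stop only where the strategy passes, so without Environment it cannot stop
before `u` is exhausted. -/
theorem take_of_compatible_playList {A : Arena} {u : List A.VocabS} {w : DataWord A}
    (hc : (playList u).Compatible w) {n : ℕ} (hn : ∀ i < n, ∀ e, w.get? i ≠ some (Sum.inr e)) :
    w.take n = (u.take n).map Sum.inl := by
  induction n with
  | zero => simp
  | succ n ih =>
    have ihn := ih fun i hi => hn i (by omega)
    rw [seq_take_add_one, List.take_add_one, List.map_append, ihn]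
    congr 1
    rcases hw : w.get? n with _ | s | e
    · have := hc.2 ⟨n, hw⟩
      rw [seq_toList_eq_take hw ⟨n, hw⟩, playList_eq_of_eq ihn] at this
      simp [this]
    · have := hc.1 n s hw
      rw [playList_eq_of_eq ihn] at this
      simp [this]
    · exact absurd hw (hn n (by omega) e)

/-- A challenge after a prefix of the list tests the last move of that prefix, which is correct
because `AllOK` passes to prefixes. -/
theorem playList_winning {s f : ℕ} {Δ : List Rule} {u : List (machineArena kS nS nE).VocabS}
    {m : (machineArena kS nS nE).VocabS} (hE : 0 < nE)
    (H : AllOK Δ s ((u ++ [m]).map moveData)) (hm : (moveData m).1 = stateLetter f) :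
    (playList (u ++ [m])).Winning (.machineFormula s Δ f) := by
  intro w hc _
  refine models_machineFormula_iff.2 ⟨hE, or_iff_not_imp_left.2 fun htwo => ?_⟩
  by_cases hno : ∀ i, ¬ EnvIndex w i
  · refine Or.inl ⟨hno, u.length, m, ?_, hm⟩
    have := take_of_compatible_playList (n := u.length + 1) hc fun i _ e he => hno i ⟨e, he⟩
    have h2 := congrArg (fun l => l[u.length]?) this
    simpa [Stream'.Seq.getElem?_take] using h2
  · push Not at hno
    obtain ⟨i, e, hi⟩ := hno
    have hother : ∀ j, j ≠ i → ∀ e', w.get? j ≠ some (Sum.inr e') := fun j hj e' he' =>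
      htwo ⟨j, i, hj, ⟨e', he'⟩, ⟨e, hi⟩⟩
    have htake := take_of_compatible_playList (n := i) hc fun j hj => hother j hj.ne
    refine Or.inr ⟨(u ++ [m]).take i, e, eq_stopWord htake hi ?_, ?_⟩
    · rcases hj : w.get? (i + 1) with _ | x | e'
      · rfl
      · have := hc.1 _ _ hj
        -- A history containing an Environment move is no image under `Sum.inl`, so the strategy
        -- passes and nothing follows the challenge.
        rw [playList] at this
        split_ifs at this with heq
        have hmem : Sum.inr e ∈ w.take (i + 1) := by simp [seq_take_add_one, hi]
        rw [heq] at hmem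
        obtain ⟨_, -, h⟩ := List.mem_map.1 hmem
        exact absurd h (by simp)
      · exact absurd hj (hother _ (by omega) e')
    · intro h' x hx
      rw [← List.take_append_drop i (u ++ [m]), hx, List.map_append, List.map_append] at H
      exact (allOK_append_singleton.1 H.of_append).2

theorem AllOK.letter_lt {Δ : List Rule} {s : ℕ} (hs : stateLetter s < kS)
    (hΔ : ∀ r ∈ Δ, stateLetter r.2.2 < kS) {h : List (ℕ × ℕ)} (H : AllOK Δ s h) :
    ∀ x ∈ h, x.1 < kS := by
  induction H with
  | nil => simp
  | snoc h x _ hx ih =>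
    intro y hy
    rcases List.mem_append.1 hy with hy | hy
    · exact ih y hy
    · obtain rfl := List.mem_singleton.1 hy
      obtain ⟨h1, -⟩ | ⟨o, h1, -⟩ | ⟨r, hr, h1, -⟩ := hx
      · rw [h1]
        exact hs
      · rw [h1]
        have := o.letter_lt
        simp only [stateLetter] at hs
        omega
      · rw [h1]
        exact hΔ r hr

theorem exists_winning_iff {s f : ℕ} {Δ : List Rule} (hs : stateLetter s < kS)
    (hΔ : ∀ r ∈ Δ, stateLetter r.2.2 < kS) :
    (∃ nS nE : ℕ, ∃ S : Strategy (machineArena kS nS nE), S.Winning (.machineFormula s Δ f)) ↔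
      CReaches Δ s (fun _ => 0) f := by
  rw [← exists_allOK_iff]
  constructor
  · rintro ⟨nS, nE, S, H⟩
    exact exists_allOK_of_winning H
  · rintro ⟨h, p, H⟩
    -- The run fixes the number of System processes: `n` exceeds every datum used. One Environment
    -- process suffices.
    obtain ⟨n, hn⟩ := ((h ++ [(stateLetter f, p)]).map Prod.snd).toFinset.exists_nat_subset_range
    obtain ⟨u, hu⟩ := exists_eq_map_of_forall
      (f := moveData (kS := kS) (nS := n) (nE := 1)) (l := h ++ [(stateLetter f, p)]) (by
        intro x hx
        have h1 := H.letter_lt hs hΔ x hx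
        have h2 : x.2 < n := Finset.mem_range.1 (hn (by
          rw [List.mem_toFinset]
          exact List.mem_map_of_mem hx))
        exact ⟨(⟨x.1, h1⟩, Sum.inl ⟨x.2, h2⟩), rfl⟩)
    obtain rfl | ⟨u', m, rfl⟩ := List.eq_nil_or_concat' u
    · simp at hu
    · rw [hu] at H
      refine ⟨n, 1, _, playList_winning one_pos H ?_⟩
      rw [List.map_append] at hu
      have := (List.append_inj' hu rfl).2
      rw [List.map_singleton, List.singleton_inj] at this
      rw [← this]

/-! ### Syntactic properties of the formula -/

namespace Formula

theorem overAlphabet_disj {k kE : ℕ} {l : List Formula} (h : ∀ φ ∈ l, φ.OverAlphabet k kE) :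
    (disj l).OverAlphabet k kE := by
  induction l with
  | nil => trivial
  | cons φ l ih => exact ⟨h φ (by simp), ih fun ψ hψ => h ψ (by simp [hψ])⟩

theorem freeVars_disj {l : List Formula} (h : ∀ φ ∈ l, φ.freeVars ⊆ {1}) :
    (disj l).freeVars ⊆ {1} := by
  induction l with
  | nil => decide
  | cons φ l ih => exact Finset.union_subset (h φ (by simp)) (ih fun ψ hψ => h ψ (by simp [hψ]))

theorem overAlphabet_machineFormula {k kE s f : ℕ} {Δ : List Rule} (hs : stateLetter s < k)
    (hf : stateLetter f < k) (hΔ : ∀ r ∈ Δ, stateLetter r.1 < k ∧ stateLetter r.2.2 < k) :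
    (machineFormula s Δ f).OverAlphabet k kE := by
  have hop : ∀ o : Op, o.letter < k := fun o => by
    have := o.letter_lt
    simp only [stateLetter] at hs
    omega
  have hext : (extFormula s Δ).OverAlphabet k kE := by
    refine ⟨⟨hs, trivial⟩, overAlphabet_disj ?_, overAlphabet_disj ?_⟩
    · intro φ hφ
      obtain ⟨o, -, rfl⟩ := List.mem_map.1 hφ
      refine ⟨hop o, ?_⟩
      rcases o with c | c | c <;> simp [opCheck, OverAlphabet, sys, hop]
    · intro φ hφ
      obtain ⟨r, hr, rfl⟩ := List.mem_map.1 hφ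
      exact ⟨(hΔ r hr).2, ⟨trivial, hop _⟩, trivial, (hΔ r hr).1⟩
  simp only [machineFormula, twoEnv, noEnv, lastEnv, envPos, OverAlphabet, sys, hf, hext, and_self]

theorem isSentence_machineFormula (s : ℕ) (Δ : List Rule) (f : ℕ) :
    (machineFormula s Δ f).IsSentence := by
  have hext : (extFormula s Δ).freeVars ⊆ {1} := by
    refine Finset.union_subset ?_ (Finset.union_subset (freeVars_disj ?_) (freeVars_disj ?_))
    · simp only [startFormula, sys, freeVars]
      decide
    · intro φ hφ
      obtain ⟨o, -, rfl⟩ := List.mem_map.1 hφ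
      rcases o with c | c | c <;> simp only [opFormula, opCheck, sys, freeVars] <;> decide
    · intro φ hφ
      obtain ⟨r, -, rfl⟩ := List.mem_map.1 hφ
      simp only [ruleFormula, sys, freeVars]
      decide
  obtain h | h := Finset.subset_singleton_iff.1 hext <;>
    simp only [IsSentence, machineFormula, twoEnv, noEnv, lastEnv, envPos, sys, freeVars, h] <;>
    decide

/-! ### The constructors of formulas are primitive recursive -/

/-- This reduces primitive recursiveness of the constructors to arithmetic on Gödel numbers. -/
theorem encode_eq_toNat (φ : Formula) : Encodable.encode φ = φ.toNat := rfl

section Primrec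

variable {α : Type*} [Primcodable α]

theorem primrec_and {f g : α → Formula} (hf : Primrec f) (hg : Primrec g) :
    Primrec fun a => and (f a) (g a) := by
  refine Primrec.encode_iff.1 ?_
  simp only [encode_eq_toNat, toNat]
  exact Primrec.nat_add.comp (Primrec.nat_mul.comp (Primrec.const 6)
    (Primrec₂.natPair.comp (Primrec.encode_iff.2 hf) (Primrec.encode_iff.2 hg))) (Primrec.const 20)

theorem primrec_or {f g : α → Formula} (hf : Primrec f) (hg : Primrec g) :
    Primrec fun a => or (f a) (g a) := by
  refine Primrec.encode_iff.1 ?_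
  simp only [encode_eq_toNat, toNat]
  exact Primrec.nat_add.comp (Primrec.nat_mul.comp (Primrec.const 6)
    (Primrec₂.natPair.comp (Primrec.encode_iff.2 hf) (Primrec.encode_iff.2 hg))) (Primrec.const 21)

theorem primrec_ex {f : α → Formula} (x : Var) (hf : Primrec f) : Primrec fun a => ex x (f a) := by
  refine Primrec.encode_iff.1 ?_
  simp only [encode_eq_toNat, toNat]
  exact Primrec.nat_add.comp (Primrec.nat_mul.comp (Primrec.const 6)
    (Primrec.nat_add.comp (Primrec.nat_mul.comp (Primrec.const 2) (Primrec.encode_iff.2 hf))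
      (Primrec.const _))) (Primrec.const 22)

theorem primrec_all {f : α → Formula} (x : Var) (hf : Primrec f) :
    Primrec fun a => all x (f a) := by
  refine Primrec.encode_iff.1 ?_
  simp only [encode_eq_toNat, toNat]
  exact Primrec.nat_add.comp (Primrec.nat_mul.comp (Primrec.const 6)
    (Primrec.nat_add.comp (Primrec.nat_mul.comp (Primrec.const 2) (Primrec.encode_iff.2 hf))
      (Primrec.const _))) (Primrec.const 23)

theorem primrec_sys {f : α → ℕ} (x : Var) (hf : Primrec f) : Primrec fun a => sys (f a) x := by
  refine Primrec.encode_iff.1 ?_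
  simp only [encode_eq_toNat, sys, toNat]
  exact Primrec.nat_add.comp (Primrec.nat_mul.comp (Primrec.const 6)
    (Primrec.nat_add.comp (Primrec.nat_mul.comp (Primrec.const 2)
      (Primrec.encode.comp (Primrec.sumInl.comp hf))) (Primrec.const _))) (Primrec.const 18)

end Primrec

end Formula

/-! ### Loading a number into a counter -/

/-- The rules of a machine with states below `K`, together with a chain of new states from `K + m`
down to `K` that adds `m` to the second counter before entering state `s`. -/
def loadRules (Δ : List Rule) (K s : ℕ) : ℕ → List Rule
  | 0 => (K, .zero 0, s) :: Δ
  | m + 1 => (K + m + 1, .inc 1, K + m) :: loadRules Δ K s m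

theorem mem_loadRules {Δ : List Rule} {K s m : ℕ} {r : Rule} : r ∈ loadRules Δ K s m ↔
    r ∈ Δ ∨ r = (K, .zero 0, s) ∨ ∃ i < m, r = (K + i + 1, .inc 1, K + i) := by
  induction m with
  | zero => simp [loadRules, or_comm]
  | succ m ih =>
    rw [loadRules, List.mem_cons, ih]
    constructor
    · rintro (h | h | h | ⟨i, hi, h⟩)
      · exact Or.inr (Or.inr ⟨m, by omega, h⟩)
      · exact Or.inl h
      · exact Or.inr (Or.inl h)
      · exact Or.inr (Or.inr ⟨i, by omega, h⟩)
    · rintro (h | h | ⟨i, hi, h⟩)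
      · exact Or.inr (Or.inl h)
      · exact Or.inr (Or.inr (Or.inl h))
      · obtain hi | rfl : i < m ∨ i = m := by omega
        · exact Or.inr (Or.inr (Or.inr ⟨i, hi, h⟩))
        · exact Or.inl h

/-- The values of the counters when only the second counter is nonzero. -/
def loaded (m : ℕ) : Fin 3 → ℕ := Function.update (fun _ => 0) 1 m

theorem inc_act_loaded (m : ℕ) : (Op.inc 1).Act (loaded m) (loaded (m + 1)) := by
  simp [Op.Act, loaded]

theorem zero_act_loaded (m : ℕ) : (Op.zero 0).Act (loaded m) (loaded m) := by
  simp [Op.Act, loaded]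

/-- States from `K` upwards have only chain rules and states below `K` only old ones, so a run first
descends the chain with state index and second counter summing to `m`. The test of the first
counter, which is still zero, is an idle instruction. -/
theorem cReaches_loadRules_iff {Δ : List Rule} {K s f m : ℕ} (hs : s < K) (hf : f < K)
    (hΔ : ∀ r ∈ Δ, r.1 < K ∧ r.2.2 < K) :
    CReaches (loadRules Δ K s m) (K + m) (fun _ => 0) f ↔ CReaches Δ s (loaded m) f := by
  have h0 : (fun _ => 0) = loaded 0 := by
    funext c
    simp [loaded]
  constructor
  · rintro ⟨v', H⟩
    have key : ∀ y, Relation.ReflTransGen (CStep (loadRules Δ K s m)) (K + m, fun _ => 0) y →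
        (∃ i j, i + j = m ∧ y = (K + i, loaded j)) ∨
        (y.1 < K ∧ Relation.ReflTransGen (CStep Δ) (s, loaded m) y) := by
      intro y hy
      induction hy with
      | refl => exact Or.inl ⟨m, 0, rfl, by rw [h0]⟩
      | @tail y z _ hstep ih =>
        obtain ⟨o, ho, hact⟩ := hstep
        obtain ⟨i, j, hij, rfl⟩ | ⟨hlt, hreach⟩ := ih
        · obtain h | h | ⟨i', hi', h⟩ := mem_loadRules.1 ho
          · have := (hΔ _ h).1
            simp at this
          · simp only [Prod.mk.injEq] at h
            obtain ⟨hi, rfl, hz⟩ := h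
            obtain rfl : i = 0 := by omega
            obtain rfl : j = m := by omega
            refine Or.inr ⟨hz ▸ hs, ?_⟩
            have : z = (s, loaded j) := Prod.ext hz (hact.unique (zero_act_loaded j))
            rw [this]
          · simp only [Prod.mk.injEq] at h
            obtain ⟨hi, rfl, hz⟩ := h
            exact Or.inl ⟨i', j + 1, by omega, Prod.ext hz (hact.unique (inc_act_loaded j))⟩
        · obtain h | h | ⟨i', hi', h⟩ := mem_loadRules.1 ho
          · exact Or.inr ⟨(hΔ _ h).2, hreach.tail ⟨o, h, hact⟩⟩
          · simp only [Prod.mk.injEq] at h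
            omega
          · simp only [Prod.mk.injEq] at h
            omega
    obtain ⟨i, j, -, h⟩ | ⟨-, h⟩ := key _ H
    · have := congrArg Prod.fst h
      simp only at this
      omega
    · exact ⟨v', h⟩
  · rintro ⟨v', H⟩
    have key : ∀ i j, i + j = m → Relation.ReflTransGen (CStep (loadRules Δ K s m))
        (K + i, loaded j) (s, loaded m) := by
      intro i
      induction i with
      | zero =>
        intro j hj
        obtain rfl : j = m := by omega
        exact .single ⟨.zero 0, mem_loadRules.2 (Or.inr (Or.inl rfl)), zero_act_loaded j⟩
      | succ i ih =>
        intro j hj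
        exact .head ⟨.inc 1, mem_loadRules.2 (Or.inr (Or.inr ⟨i, by omega, rfl⟩)),
          inc_act_loaded j⟩ (ih (j + 1) (by omega))
    refine ⟨v', (h0 ▸ key m 0 rfl).trans (Relation.ReflTransGen.mono ?_ _ _ H)⟩
    rintro x y ⟨o, ho, hact⟩
    exact ⟨o, mem_loadRules.2 (Or.inl ho), hact⟩

/-- Only the start letter and the disjunction over rules depend on `m`; the latter gains one
disjunct per step, hence is given by primitive recursion. -/
theorem primrec_machineFormula_loadRules (Δ : List Rule) (K s f : ℕ) :
    Primrec fun m => Formula.machineFormula (K + m) (loadRules Δ K s m) f := by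
  have hst : ∀ {α : Type} [Primcodable α] {g : α → ℕ}, Primrec g →
      Primrec fun a => stateLetter (g a) := fun hg => Primrec.nat_add.comp (Primrec.const 9) hg
  have hK : Primrec fun m => K + m := Primrec.nat_add.comp (Primrec.const K) Primrec.id
  have hdisj : Primrec fun m => Formula.disj ((loadRules Δ K s m).map Formula.ruleFormula) := by
    have hrec := Primrec.nat_rec₁
      (f := fun i φ => Formula.or (Formula.ruleFormula (K + i + 1, .inc 1, K + i)) φ)
      (Formula.disj ((loadRules Δ K s 0).map Formula.ruleFormula)) (by
        refine Formula.primrec_or ?_ Primrec.snd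
        have hi : Primrec fun p : ℕ × Formula => K + p.1 := hK.comp Primrec.fst
        refine Formula.primrec_and (Formula.primrec_sys 1 (hst hi)) (Formula.primrec_ex 0
          (Formula.primrec_and
            (Primrec.const (Formula.and (.succ 1 0) (.sys (Op.inc 1).letter 0)))
            (Formula.primrec_ex 1 (Formula.primrec_and (Primrec.const _)
              (Formula.primrec_sys 1 (hst ?_))))))
        exact Primrec.nat_add.comp hi (Primrec.const 1))
    refine hrec.of_eq fun m => ?_
    induction m with
    | zero => rfl
    | succ m ih =>
      simp only at ih ⊢
      rw [ih]
      rfl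
  refine Formula.primrec_and (Primrec.const _) (Formula.primrec_or (Primrec.const _)
    (Formula.primrec_or (Primrec.const _) (Formula.primrec_ex 0 (Formula.primrec_and
      (Primrec.const _) (Formula.primrec_and (Primrec.const _) (Formula.primrec_all 1
        (Formula.primrec_or (Primrec.const _) (Formula.primrec_or ?_
          (Formula.primrec_or (Primrec.const _) hdisj)))))))))
  exact Formula.primrec_and (Formula.primrec_sys 1 (hst hK)) (Primrec.const _)

/-- The synthesis problem is undecidable if the halting problem of some counter machine is. -/
theorem not_computablePred_partSynth {Δ : List Rule} {K s f : ℕ} (hs : s < K) (hf : f < K)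
    (hΔ : ∀ r ∈ Δ, r.1 < K ∧ r.2.2 < K) {g : ℕ → ℕ} (hg : Computable g)
    (H : ¬ ComputablePred fun n => CReaches Δ s (loaded (g n)) f) :
    ¬ ComputablePred PartSynthFO2SimSucc := by
  refine fun hp => H ?_
  -- State letters are `9 + q` with `q ≤ K + m`, so `10 + K + m` System actions suffice.
  let F : ℕ → ℕ × ℕ × Formula := fun m =>
    (10 + K + m, 1, Formula.machineFormula (K + m) (loadRules Δ K s m) f)
  have hF : Primrec F := Primrec.pair (Primrec.nat_add.comp (Primrec.const _) Primrec.id)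
    (Primrec.pair (Primrec.const _) (primrec_machineFormula_loadRules Δ K s f))
  refine ComputablePred.computable_of_manyOneReducible
    (q := PartSynthFO2SimSucc) ⟨fun n => F (g n), hF.to_comp.comp hg, fun n => ?_⟩ hp
  change CReaches Δ s (loaded (g n)) f ↔ PartSynthFO2SimSucc (F (g n))
  generalize g n = m
  rw [← cReaches_loadRules_iff hs hf hΔ]
  have hbound : ∀ r ∈ loadRules Δ K s m,
      stateLetter r.1 < 10 + K + m ∧ stateLetter r.2.2 < 10 + K + m := by
    intro r hr
    simp only [stateLetter]
    obtain h | rfl | ⟨i, hi, rfl⟩ := mem_loadRules.1 hr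
    · have := hΔ r h
      omega
    · simp only
      omega
    · simp only
      omega
  have hstart : stateLetter (K + m) < 10 + K + m := by
    simp only [stateLetter]
    omega
  rw [← exists_winning_iff (kS := 10 + K + m) hstart fun r hr => (hbound r hr).2]
  have hfin : stateLetter f < 10 + K + m := by
    simp only [stateLetter]
    omega
  exact ⟨fun h => ⟨Formula.overAlphabet_machineFormula hstart hfin hbound,
    Formula.isSentence_machineFormula _ _ _, h⟩, fun h => h.2.2⟩

/-! ### Counter machines over arbitrary states -/

/-- One step of a counter machine with transition relation `T`. -/
def GStep {σ : Type*} (T : σ → Op → σ → Prop) (x y : σ × (Fin 3 → ℕ)) : Prop :=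
  ∃ o, T x.1 o y.1 ∧ o.Act x.2 y.2

theorem finite_op : Finite Op :=
  Set.finite_univ_iff.1 ((List.finite_toSet Op.list).subset fun o _ => o.mem_list)

/-- A counter machine with finitely many states can be given by a list of rules. -/
theorem exists_rules {σ : Type*} [Finite σ] (T : σ → Op → σ → Prop) (s f : σ) :
    ∃ (Δ : List Rule) (K s' f' : ℕ), s' < K ∧ f' < K ∧ (∀ r ∈ Δ, r.1 < K ∧ r.2.2 < K) ∧
      ∀ v, CReaches Δ s' v f' ↔ ∃ v', Relation.ReflTransGen (GStep T) (s, v) (f, v') := by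
  have := finite_op
  obtain ⟨K, ⟨e⟩⟩ := Finite.exists_equiv_fin σ
  let g : σ × Op × σ → Rule := fun x => ((e x.1).val, x.2.1, (e x.2.2).val)
  -- The rules may be listed by choice: the machine stays fixed throughout the reduction.
  have hfin : {x : σ × Op × σ | T x.1 x.2.1 x.2.2}.Finite := Set.toFinite _
  have hmem : ∀ r, r ∈ hfin.toFinset.toList.map g ↔ ∃ a o a', T a o a' ∧ g (a, o, a') = r := by
    intro r
    simp
  refine ⟨hfin.toFinset.toList.map g, K, e s, e f, (e s).isLt, (e f).isLt, ?_, fun v => ?_⟩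
  · intro r hr
    obtain ⟨a, o, a', -, rfl⟩ := (hmem r).1 hr
    exact ⟨(e a).isLt, (e a').isLt⟩
  · constructor
    · rintro ⟨v', H⟩
      refine ⟨v', ?_⟩
      have key : ∀ y, Relation.ReflTransGen (CStep (hfin.toFinset.toList.map g)) ((e s).val, v) y →
          ∃ a, y.1 = (e a).val ∧ Relation.ReflTransGen (GStep T) (s, v) (a, y.2) := by
        intro y hy
        induction hy with
        | refl => exact ⟨s, rfl, .refl⟩
        | tail _ hstep ih =>
          obtain ⟨a, ha, hreach⟩ := ih
          obtain ⟨o, ho, hact⟩ := hstep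
          obtain ⟨a₁, o₁, a₂, hT, heq⟩ := (hmem _).1 ho
          simp only [g, ha, Prod.mk.injEq, Fin.val_inj, EmbeddingLike.apply_eq_iff_eq] at heq
          obtain ⟨rfl, rfl, h2⟩ := heq
          exact ⟨a₂, h2.symm, hreach.tail ⟨o₁, hT, hact⟩⟩
      obtain ⟨a, ha, h⟩ := key _ H
      simp only [Fin.val_inj, EmbeddingLike.apply_eq_iff_eq] at ha
      exact ha ▸ h
    · rintro ⟨v', H⟩
      refine ⟨v', ?_⟩
      refine Relation.ReflTransGen.lift (fun y : σ × (Fin 3 → ℕ) => ((e y.1).val, y.2)) ?_ _ _ H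
      rintro x y ⟨o, hT, hact⟩
      exact ⟨o, (hmem _).2 ⟨_, _, _, hT, rfl⟩, hact⟩

/-! ### Turing machines whose half-tapes are numbers -/

/-- A configuration of a Turing machine with `b` symbols: the state, the scanned symbol, and
the left (`false`) and right (`true`) half-tapes, as numbers in base `b`. -/
@[ext]
structure NumCfg (Q : Type*) (b : ℕ) where
  state : Q
  head : Fin b
  tape : Bool → ℕ

variable {Q : Type*} {b : ℕ}

/-- A program tells for a state and a scanned symbol the next state, and whether to move left
(`false`) or right (`true`) or which symbol to write, or to halt. -/
abbrev Program (Q : Type*) (b : ℕ) : Type _ := Q → Fin b → Option (Q × (Bool ⊕ Fin b))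

/-- The half-tapes after moving in direction `d` from a symbol. -/
def moveTape (d : Bool) (h : Fin b) (s : Bool → ℕ) : Bool → ℕ :=
  fun d' => if d' = d then s d / b else b * s d' + h

/-- One step of the program. -/
def numStep (δ : Program Q b) (c : NumCfg Q b) : Option (NumCfg Q b) :=
  (δ c.state c.head).map fun x => match x.2 with
    | Sum.inl d => ⟨x.1, ⟨c.tape d % b, Nat.mod_lt _ c.head.pos⟩, moveTape d c.head c.tape⟩
    | Sum.inr a => ⟨x.1, a, c.tape⟩

/-- The program halts from a configuration. -/
def NumHalts (δ : Program Q b) (c : NumCfg Q b) : Prop :=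
  ∃ c', Relation.ReflTransGen (fun x y => y ∈ numStep δ x) c c' ∧ δ c'.state c'.head = none

/-! ### The counter machine of a program -/

/-- The states of the counter machine of a program. -/
inductive CState (Q : Type*) (b : ℕ) : Type _
  /-- The configuration of the program is in the first two counters. -/
  | main (q : Q) (h : Fin b)
  /-- The stack that receives the symbol `h` is multiplied into the third counter. -/
  | mul (q : Q) (d : Bool) (h : Fin b)
  | mulInc (q : Q) (d : Bool) (h : Fin b) (j : Fin b)
  /-- The number `j` and the third counter are added to the stack. -/
  | add (q : Q) (d : Bool) (j : Fin (b + 1))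
  /-- The other stack is divided into the third counter, with `j` as the current remainder. -/
  | div (q : Q) (d : Bool) (j : Fin (b + 1))
  /-- The third counter is moved to the other stack. -/
  | rest (q : Q) (d : Bool) (j : Fin b)
  | restInc (q : Q) (d : Bool) (j : Fin b)
  | halt

instance [Finite Q] : Finite (CState Q b) := by
  let F (s : CState Q b) : Option (Fin 7 × Q × Bool × Fin (b + 1) × Fin (b + 1)) := match s with
    | .main q h => some (0, q, true, h.castSucc, 0)
    | .mul q d h => some (1, q, d, h.castSucc, 0)
    | .mulInc q d h j => some (2, q, d, h.castSucc, j.castSucc)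
    | .add q d j => some (3, q, d, j, 0)
    | .div q d j => some (4, q, d, j, 0)
    | .rest q d j => some (5, q, d, j.castSucc, 0)
    | .restInc q d j => some (6, q, d, j.castSucc, 0)
    | .halt => none
  refine Finite.of_injective F fun x y h => ?_
  cases x <;> cases y <;> simp_all [F]

/-- The counter of a half-tape. -/
def sideCounter : Bool → Fin 3
  | false => 0
  | true => 1

@[simp] theorem sideCounter_ne_two (d : Bool) : sideCounter d ≠ 2 := by cases d <;> decide

@[simp] theorem two_ne_sideCounter (d : Bool) : 2 ≠ sideCounter d := by cases d <;> decide

@[simp] theorem sideCounter_not_ne (d : Bool) : sideCounter (!d) ≠ sideCounter d := by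
  cases d <;> decide

@[simp] theorem sideCounter_ne_not (d : Bool) : sideCounter d ≠ sideCounter (!d) := by
  cases d <;> decide

/-- The transitions of the counter machine of a program. -/
inductive CTrans (δ : Program Q b) : CState Q b → Op → CState Q b → Prop
  | halt {q h} : δ q h = none → CTrans δ (.main q h) (.zero 2) .halt
  | write {q h q' a} : δ q h = some (q', Sum.inr a) → CTrans δ (.main q h) (.zero 2) (.main q' a)
  | move {q h q' d} : δ q h = some (q', Sum.inl d) → CTrans δ (.main q h) (.zero 2) (.mul q' d h)
  | mulDec {q d h j} : j.val + 1 = b →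
      CTrans δ (.mul q d h) (.dec (sideCounter (!d))) (.mulInc q d h j)
  | mulInc {q d h j j'} : j'.val + 1 = j.val →
      CTrans δ (.mulInc q d h j) (.inc 2) (.mulInc q d h j')
  | mulIncEnd {q d h j} : j.val = 0 → CTrans δ (.mulInc q d h j) (.inc 2) (.mul q d h)
  | mulEnd {q d h j} : j.val = h.val →
      CTrans δ (.mul q d h) (.zero (sideCounter (!d))) (.add q d j)
  | addInc {q d j j'} : j'.val + 1 = j.val →
      CTrans δ (.add q d j) (.inc (sideCounter (!d))) (.add q d j')
  | addDec {q d j j'} : j.val = 0 → j'.val = 1 → CTrans δ (.add q d j) (.dec 2) (.add q d j')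
  | addEnd {q d j j'} : j.val = 0 → j'.val = 0 → CTrans δ (.add q d j) (.zero 2) (.div q d j')
  | divDec {q d j j'} : j'.val = j.val + 1 →
      CTrans δ (.div q d j) (.dec (sideCounter d)) (.div q d j')
  | divInc {q d j j'} : j.val = b → j'.val = 0 → CTrans δ (.div q d j) (.inc 2) (.div q d j')
  | divEnd {q d j j'} : j.val = j'.val →
      CTrans δ (.div q d j) (.zero (sideCounter d)) (.rest q d j')
  | restDec {q d j} : CTrans δ (.rest q d j) (.dec 2) (.restInc q d j)
  | restInc {q d j} : CTrans δ (.restInc q d j) (.inc (sideCounter d)) (.rest q d j)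
  | restEnd {q d j} : CTrans δ (.rest q d j) (.zero 2) (.main q j)

/-- The counter machine is simulating the step into the given configuration. -/
def Simulates : CState Q b → (Fin 3 → ℕ) → NumCfg Q b → Prop
  | .main q h, v, c => c = ⟨q, h, fun d => v (sideCounter d)⟩
  | .mul q d h, v, c => c.state = q ∧ c.tape (!d) = b * v (sideCounter (!d)) + v 2 + h ∧
      v (sideCounter d) = b * c.tape d + c.head
  | .mulInc q d h j, v, c => c.state = q ∧
      c.tape (!d) = b * v (sideCounter (!d)) + v 2 + (j + 1) + h ∧
      v (sideCounter d) = b * c.tape d + c.head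
  | .add q d j, v, c => c.state = q ∧ c.tape (!d) = v (sideCounter (!d)) + v 2 + j ∧
      v (sideCounter d) = b * c.tape d + c.head
  | .div q d j, v, c => c.state = q ∧ c.tape (!d) = v (sideCounter (!d)) ∧
      v (sideCounter d) + j + b * v 2 = b * c.tape d + c.head
  | .rest q d j, v, c => c.state = q ∧ c.tape (!d) = v (sideCounter (!d)) ∧ c.head = j ∧
      c.tape d = v (sideCounter d) + v 2
  | .restInc q d j, v, c => c.state = q ∧ c.tape (!d) = v (sideCounter (!d)) ∧ c.head = j ∧
      c.tape d = v (sideCounter d) + v 2 + 1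
  | .halt, _, _ => False

/-- The configuration `c` is the target of the program step in progress, and `Simulates` expresses
it by the current counters. Only transitions leaving `main` change the target; all others preserve
these equations, so determinism of the counter machine is not needed. At `main` the third counter is
unconstrained, but every exit tests it for zero. -/
theorem simulates_step {δ : Program Q b} {x y : CState Q b × (Fin 3 → ℕ)} {c : NumCfg Q b}
    (hc : Simulates x.1 x.2 c) (h : GStep (CTrans δ) x y) :
    (y.1 = .halt ∧ δ c.state c.head = none) ∨
      ∃ c', (c' = c ∨ c' ∈ numStep δ c) ∧ Simulates y.1 y.2 c' := by
  obtain ⟨s, v⟩ := x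
  obtain ⟨s', v'⟩ := y
  obtain ⟨o, hT, hact⟩ := h
  simp only at hT hact hc
  cases hT with
  | halt hδ =>
    subst hc
    exact Or.inl ⟨rfl, hδ⟩
  | write hδ =>
    subst hc
    obtain ⟨-, rfl⟩ := hact
    exact Or.inr ⟨_, Or.inr (by simp [numStep, hδ]), rfl⟩
  | @move q h q' d hδ =>
    subst hc
    obtain ⟨h2, rfl⟩ := hact
    refine Or.inr ⟨_, Or.inr (by simp only [numStep, hδ]; rfl), rfl, ?_, ?_⟩
    · simp [moveTape, h2]
    · simp [moveTape, Nat.div_add_mod]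
  | mulDec hj =>
    obtain ⟨h1, rfl⟩ := hact
    obtain ⟨x, hx⟩ := Nat.exists_eq_succ_of_ne_zero h1
    refine Or.inr ⟨c, Or.inl rfl, hc.1, ?_, ?_⟩
    · simp [hc.2.1, hx, Nat.mul_succ]
      omega
    · simp [hc.2.2]
  | mulInc hj =>
    obtain rfl := hact
    refine Or.inr ⟨c, Or.inl rfl, hc.1, ?_, ?_⟩
    · simp [hc.2.1]
      omega
    · simp [hc.2.2]
  | mulIncEnd hj =>
    obtain rfl := hact
    refine Or.inr ⟨c, Or.inl rfl, hc.1, ?_, ?_⟩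
    · simp [hc.2.1, hj]
      omega
    · simp [hc.2.2]
  | mulEnd hj =>
    obtain ⟨h1, rfl⟩ := hact
    exact Or.inr ⟨c, Or.inl rfl, hc.1, by simp [hc.2.1, h1, hj], hc.2.2⟩
  | addInc hj =>
    obtain rfl := hact
    refine Or.inr ⟨c, Or.inl rfl, hc.1, ?_, ?_⟩
    · simp [hc.2.1]
      omega
    · simp [hc.2.2]
  | addDec hj hj' =>
    obtain ⟨h1, rfl⟩ := hact
    refine Or.inr ⟨c, Or.inl rfl, hc.1, ?_, ?_⟩
    · simp [hc.2.1]
      omega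
    · simp [hc.2.2]
  | addEnd hj hj' =>
    obtain ⟨h1, rfl⟩ := hact
    exact Or.inr ⟨c, Or.inl rfl, hc.1, by simp [hc.2.1, h1, hj], by simp [hc.2.2, h1, hj']⟩
  | divDec hj =>
    obtain ⟨h1, rfl⟩ := hact
    refine Or.inr ⟨c, Or.inl rfl, hc.1, ?_, ?_⟩
    · simp [hc.2.1]
    · rw [← hc.2.2]
      simp
      omega
  | divInc hj hj' =>
    obtain rfl := hact
    refine Or.inr ⟨c, Or.inl rfl, hc.1, ?_, ?_⟩
    · simp [hc.2.1]
    · rw [← hc.2.2]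
      simp [hj, hj', Nat.mul_succ]
      omega
  -- Both sides of the invariant are divisions by `b` with remainder below `b`, so remainders and
  -- quotients agree.
  | @divEnd q d j j' hj =>
    obtain ⟨h1, rfl⟩ := hact
    have key := hc.2.2
    rw [h1, hj, zero_add] at key
    have hb := j'.pos
    have h3 : j'.val = c.head.val := by
      have := congrArg (· % b) key
      simpa [Nat.mod_eq_of_lt] using this
    refine Or.inr ⟨c, Or.inl rfl, hc.1, hc.2.1, Fin.ext h3.symm, ?_⟩
    have h4 : b * c.tape d = b * v' 2 := by omega
    simp only [h1, zero_add]
    exact Nat.eq_of_mul_eq_mul_left hb h4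
  | restDec =>
    obtain ⟨h1, rfl⟩ := hact
    refine Or.inr ⟨c, Or.inl rfl, hc.1, ?_, hc.2.2.1, ?_⟩
    · simp [hc.2.1]
    · simp [hc.2.2.2]
      omega
  | restInc =>
    obtain rfl := hact
    refine Or.inr ⟨c, Or.inl rfl, hc.1, ?_, hc.2.2.1, ?_⟩
    · simp [hc.2.1]
    · simp [hc.2.2.2]
      omega
  | @restEnd q d j =>
    obtain ⟨h1, rfl⟩ := hact
    refine Or.inr ⟨c, Or.inl rfl, NumCfg.ext hc.1 hc.2.2.1 (funext fun d' => ?_)⟩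
    obtain rfl | rfl : d' = d ∨ d' = !d := by cases d <;> cases d' <;> simp
    · simp [hc.2.2.2, h1]
    · exact hc.2.1

/-- The simulation invariant is carried along the run; `halt` has no outgoing transition and
simulates no configuration. -/
theorem numHalts_of_reaches {δ : Program Q b} {s : CState Q b} {v v' : Fin 3 → ℕ} {c : NumCfg Q b}
    (hc : Simulates s v c) (h : Relation.ReflTransGen (GStep (CTrans δ)) (s, v) (.halt, v')) :
    NumHalts δ c := by
  have key : ∀ y, Relation.ReflTransGen (GStep (CTrans δ)) (s, v) y →
      (y.1 = .halt ∧ NumHalts δ c) ∨ ∃ c', Relation.ReflTransGen (fun x y => y ∈ numStep δ x) c c' ∧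
        Simulates y.1 y.2 c' := by
    intro y hy
    induction hy with
    | refl => exact Or.inr ⟨c, .refl, hc⟩
    | @tail y z _ hstep ih =>
      obtain ⟨hy, -⟩ | ⟨c', hreach, hsim⟩ := ih
      · obtain ⟨o, hT, -⟩ := hstep
        rw [hy] at hT
        cases hT
      · obtain ⟨hz, hnone⟩ | ⟨c'', rfl | hc'', hsim'⟩ := simulates_step hsim hstep
        · exact Or.inl ⟨hz, c', hreach, hnone⟩
        · exact Or.inr ⟨_, hreach, hsim'⟩
        · exact Or.inr ⟨_, hreach.tail hc'', hsim'⟩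
  obtain ⟨-, H⟩ | ⟨c', -, hsim⟩ := key _ h
  · exact H
  · exact hsim.elim

/-! ### The counter machine can simulate every step -/

/-- The counters with value `y` for the half-tape in direction `d`, value `x` for the other
half-tape, and value `t` for the third counter. -/
def counterValues (d : Bool) (x y t : ℕ) : Fin 3 → ℕ :=
  fun c => if c = 2 then t else if c = sideCounter d then y else x

theorem counterValues_two (d : Bool) (x y t : ℕ) : counterValues d x y t 2 = t := by
  simp [counterValues]

theorem counterValues_side (d : Bool) (x y t : ℕ) :
    counterValues d x y t (sideCounter d) = y := by
  simp [counterValues]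

theorem counterValues_not (d : Bool) (x y t : ℕ) :
    counterValues d x y t (sideCounter (!d)) = x := by
  simp [counterValues]

theorem inc_act_two {d : Bool} {x y t : ℕ} :
    (Op.inc 2).Act (counterValues d x y t) (counterValues d x y (t + 1)) := by
  funext c
  cases d <;> fin_cases c <;> simp [counterValues, sideCounter]

theorem inc_act_side {d : Bool} {x y t : ℕ} :
    (Op.inc (sideCounter d)).Act (counterValues d x y t) (counterValues d x (y + 1) t) := by
  funext c
  cases d <;> fin_cases c <;> simp [counterValues, sideCounter]

theorem inc_act_not {d : Bool} {x y t : ℕ} :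
    (Op.inc (sideCounter (!d))).Act (counterValues d x y t) (counterValues d (x + 1) y t) := by
  funext c
  cases d <;> fin_cases c <;> simp [counterValues, sideCounter]

theorem dec_act_two {d : Bool} {x y t : ℕ} :
    (Op.dec 2).Act (counterValues d x y (t + 1)) (counterValues d x y t) := by
  refine ⟨by simp [counterValues], ?_⟩
  funext c
  cases d <;> fin_cases c <;> simp [counterValues, sideCounter]

theorem dec_act_side {d : Bool} {x y t : ℕ} :
    (Op.dec (sideCounter d)).Act (counterValues d x (y + 1) t) (counterValues d x y t) := by
  refine ⟨by simp [counterValues], ?_⟩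
  funext c
  cases d <;> fin_cases c <;> simp [counterValues, sideCounter]

theorem dec_act_not {d : Bool} {x y t : ℕ} :
    (Op.dec (sideCounter (!d))).Act (counterValues d (x + 1) y t) (counterValues d x y t) := by
  refine ⟨by simp [counterValues], ?_⟩
  funext c
  cases d <;> fin_cases c <;> simp [counterValues, sideCounter]

theorem zero_act_two {d : Bool} {x y : ℕ} :
    (Op.zero 2).Act (counterValues d x y 0) (counterValues d x y 0) :=
  ⟨counterValues_two _ _ _ _, rfl⟩

theorem zero_act_side {d : Bool} {x t : ℕ} :
    (Op.zero (sideCounter d)).Act (counterValues d x 0 t) (counterValues d x 0 t) :=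
  ⟨counterValues_side _ _ _ _, rfl⟩

theorem zero_act_not {d : Bool} {y t : ℕ} :
    (Op.zero (sideCounter (!d))).Act (counterValues d 0 y t) (counterValues d 0 y t) :=
  ⟨counterValues_not _ _ _ _, rfl⟩

section Complete

variable {δ : Program Q b} {q : Q} {d : Bool} {h : Fin b} {x y t : ℕ}

/-- Reachability between configurations of the counter machine of a program. -/
abbrev CTReaches (δ : Program Q b) :=
  Relation.ReflTransGen (GStep (CTrans δ))

theorem CTrans.head {s s' : CState Q b} {o : Op} {v v' : Fin 3 → ℕ}
    {z : CState Q b × (Fin 3 → ℕ)} (hT : CTrans δ s o s') (hact : o.Act v v')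
    (H : CTReaches δ (s', v') z) : CTReaches δ (s, v) z :=
  Relation.ReflTransGen.head ⟨o, hT, hact⟩ H

theorem reaches_mulInc (j : ℕ) (hj : j < b) (t : ℕ) :
    CTReaches δ (.mulInc q d h ⟨j, hj⟩, counterValues d x y t)
      (.mul q d h, counterValues d x y (t + (j + 1))) := by
  induction j generalizing t with
  | zero => exact CTrans.head (.mulIncEnd rfl) inc_act_two .refl
  | succ j ih =>
    refine CTrans.head (.mulInc (j' := ⟨j, by omega⟩) rfl) inc_act_two ?_
    have := ih (by omega) (t + 1)
    rwa [show t + 1 + (j + 1) = t + (j + 1 + 1) by omega] at this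

theorem reaches_mul (x t : ℕ) : CTReaches δ (.mul q d h, counterValues d x y t)
    (.mul q d h, counterValues d 0 y (t + b * x)) := by
  induction x generalizing t with
  | zero => exact .refl
  | succ x ih =>
    have hb := h.pos
    -- The state `mulInc` with index `j` performs `j + 1` increments, so `b - 1` yields `b` of them.
    refine CTrans.head (.mulDec (j := ⟨b - 1, by omega⟩) (by simp only; omega)) dec_act_not ?_
    refine (reaches_mulInc _ _ t).trans ?_
    have := ih (t + b)
    rwa [show t + b + b * x = t + b * (x + 1) by ring,
      show t + b = t + (b - 1 + 1) by omega] at this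

theorem reaches_add (j : ℕ) (hj : j < b + 1) (x : ℕ) :
    CTReaches δ (.add q d ⟨j, hj⟩, counterValues d x y t)
      (.add q d 0, counterValues d (x + j) y t) := by
  induction j generalizing x with
  | zero => exact .refl
  | succ j ih =>
    refine CTrans.head (.addInc (j' := ⟨j, by omega⟩) rfl) inc_act_not ?_
    have := ih (by omega) (x + 1)
    rwa [show x + 1 + j = x + (j + 1) by omega] at this

theorem reaches_add_zero (hb : 0 < b) (t x : ℕ) :
    CTReaches δ (.add q d 0, counterValues d x y t)
      (.add q d 0, counterValues d (x + t) y 0) := by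
  induction t generalizing x with
  | zero => exact .refl
  | succ t ih =>
    refine CTrans.head (.addDec (j' := ⟨1, by omega⟩) rfl rfl) dec_act_two ?_
    refine (reaches_add 1 (by omega) x).trans ?_
    have := ih (x + 1)
    rwa [show x + 1 + t = x + (t + 1) by omega] at this

theorem reaches_div_rem (i j : ℕ) (hj : j + i < b + 1) (y : ℕ) :
    CTReaches δ (.div q d ⟨j, by omega⟩, counterValues d x (y + i) t)
      (.div q d ⟨j + i, hj⟩, counterValues d x y t) := by
  induction i generalizing j with
  | zero => exact .refl
  | succ i ih =>
    refine CTrans.head (.divDec (j' := ⟨j + 1, by omega⟩) rfl) (dec_act_side (y := y + i)) ?_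
    have := ih (j + 1) (by omega)
    simpa only [show j + 1 + i = j + (i + 1) by omega] using this

theorem reaches_div (k y t : ℕ) :
    CTReaches δ (.div q d 0, counterValues d x (b * k + y) t)
      (.div q d 0, counterValues d x y (t + k)) := by
  induction k generalizing t with
  | zero =>
    rw [Nat.mul_zero, Nat.zero_add]
    exact .refl
  | succ k ih =>
    have h1 := reaches_div_rem (δ := δ) (q := q) (d := d) (x := x) (t := t) b 0 (by omega)
      (b * k + y)
    rw [show b * k + y + b = b * (k + 1) + y by ring] at h1
    refine h1.trans (CTrans.head (.divInc (j' := 0) (Nat.zero_add b) rfl) inc_act_two ?_)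
    have := ih (t + 1)
    rwa [show t + 1 + k = t + (k + 1) by omega] at this

theorem reaches_rest (t y : ℕ) :
    CTReaches δ (.rest q d h, counterValues d x y t)
      (.rest q d h, counterValues d x (y + t) 0) := by
  induction t generalizing y with
  | zero => exact .refl
  | succ t ih =>
    refine CTrans.head .restDec dec_act_two (CTrans.head .restInc inc_act_side ?_)
    have := ih (y + 1)
    rwa [show y + 1 + t = y + (t + 1) by omega] at this

theorem reaches_main_of_div (k : ℕ) :
    CTReaches δ (.div q d 0, counterValues d x (b * k + h) 0)
      (.main q h, counterValues d x k 0) := by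
  have h1 := reaches_div (δ := δ) (q := q) (d := d) (x := x) k h 0
  have h2 := reaches_div_rem (δ := δ) (q := q) (d := d) (x := x) (t := k) h 0 (by omega) 0
  simp only [Nat.zero_add] at h1 h2
  have h3 := reaches_rest (δ := δ) (q := q) (d := d) (x := x) (h := h) k 0
  rw [Nat.zero_add] at h3
  refine h1.trans (h2.trans (CTrans.head (.divEnd rfl) zero_act_side
    (h3.trans (CTrans.head .restEnd zero_act_two .refl))))

/-- A head move pushes the old symbol onto the stack left behind (multiply by `b`, add `h`) and pops
the new one from the other (divide by `b`, keeping the remainder in the state). -/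
theorem reaches_main_of_mul (k : ℕ) (h' : Fin b) :
    CTReaches δ (.mul q d h, counterValues d x (b * k + h') 0)
      (.main q h', counterValues d (b * x + h) k 0) := by
  have h1 := reaches_mul (δ := δ) (q := q) (d := d) (h := h) (y := b * k + h') x 0
  have h2 := reaches_add (δ := δ) (q := q) (d := d) (y := b * k + h') (t := b * x) h (by omega) 0
  have h3 := reaches_add_zero (δ := δ) (q := q) (d := d) (y := b * k + h') h.pos (b * x) h
  simp only [Nat.zero_add] at h1 h2
  rw [Nat.add_comm (b * x)]
  refine h1.trans (CTrans.head (.mulEnd rfl) zero_act_not (h2.trans (h3.trans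
    (CTrans.head (.addEnd rfl rfl) zero_act_two (reaches_main_of_div k)))))

/-- The counters that hold the half-tapes. -/
def tapeValues (s : Bool → ℕ) : Fin 3 → ℕ := counterValues true (s false) (s true) 0

theorem tapeValues_eq (d : Bool) (s : Bool → ℕ) :
    tapeValues s = counterValues d (s !d) (s d) 0 := by
  funext c
  cases d <;> fin_cases c <;> simp [tapeValues, counterValues, sideCounter]

theorem reaches_of_numStep {c c' : NumCfg Q b} (hc : c' ∈ numStep δ c) :
    CTReaches δ (.main c.state c.head, tapeValues c.tape)
      (.main c'.state c'.head, tapeValues c'.tape) := by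
  simp only [numStep, Option.mem_def, Option.map_eq_some_iff] at hc
  obtain ⟨⟨q', d | a⟩, hδ, rfl⟩ := hc
  · have := reaches_main_of_mul (δ := δ) (q := q') (d := d) (h := c.head) (x := c.tape !d)
      (c.tape d / b) ⟨c.tape d % b, Nat.mod_lt _ c.head.pos⟩
    simp only [Nat.div_add_mod] at this
    dsimp only
    rw [tapeValues_eq d c.tape, tapeValues_eq d (moveTape d c.head c.tape)]
    refine CTrans.head (.move hδ) zero_act_two ?_
    simpa [moveTape] using this
  · exact CTrans.head (.write hδ) zero_act_two .refl

/-- Starting inside the division phase splits the loaded number into the scanned symbol and the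
right half-tape, so no separate initialisation is required. -/
theorem reaches_halt_iff {m : ℕ} (hb : 0 < b) :
    (∃ v', CTReaches δ (.div q true 0, loaded m) (.halt, v')) ↔
      NumHalts δ ⟨q, ⟨m % b, Nat.mod_lt _ hb⟩, fun d => if d then m / b else 0⟩ := by
  have hload : loaded m = counterValues true 0 m 0 := by
    funext c
    fin_cases c <;> simp [loaded, counterValues, sideCounter]
  rw [hload]
  constructor
  · rintro ⟨v', H⟩
    refine numHalts_of_reaches (s := .div q true 0) ⟨rfl, ?_, ?_⟩ H
    · rw [counterValues_not]
      rfl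
    · rw [counterValues_side, counterValues_two]
      simp [Nat.div_add_mod]
  · rintro ⟨c', hreach, hnone⟩
    have h1 := reaches_main_of_div (δ := δ) (q := q) (d := true) (x := 0)
      (h := ⟨m % b, Nat.mod_lt _ hb⟩) (m / b)
    simp only [Nat.div_add_mod] at h1
    have h2 : ∀ c'', Relation.ReflTransGen (fun x y => y ∈ numStep δ x)
        ⟨q, ⟨m % b, Nat.mod_lt _ hb⟩, fun d => if d then m / b else 0⟩ c'' →
        CTReaches δ (.main q ⟨m % b, Nat.mod_lt _ hb⟩, counterValues true 0 (m / b) 0)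
          (.main c''.state c''.head, tapeValues c''.tape) := by
      intro c'' hc''
      induction hc'' with
      | refl => exact .refl
      | tail _ hstep ih => exact ih.trans (reaches_of_numStep hstep)
    exact ⟨_, h1.trans ((h2 _ hreach).trans (CTrans.head (.halt hnone) zero_act_two .refl))⟩

end Complete

open Turing

/-! ### Turing machines as programs -/

section TuringProgram

variable {Γ : Type*} [Inhabited Γ] {b : ℕ}

/-- The number whose digits are the symbols on a half-tape. -/
def ListBlank.val (e : Γ ≃ Fin b) (he : (e default).val = 0) (l : ListBlank Γ) : ℕ :=
  l.liftOn (fun l => Nat.ofDigits b (l.map fun a => (e a).val)) <| by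
    -- Trailing blanks are zero digits, so the value does not depend on the representative.
    rintro l _ ⟨n, rfl⟩
    have : Nat.ofDigits b (List.replicate n 0) = 0 := by
      induction n with
      | zero => rfl
      | succ n ih => rw [List.replicate_succ, Nat.ofDigits_cons, ih]; simp
    simp [Nat.ofDigits_append, he, this]

variable {e : Γ ≃ Fin b} {he : (e default).val = 0}

theorem ListBlank.val_mk (l : List Γ) :
    ListBlank.val e he (ListBlank.mk l) = Nat.ofDigits b (l.map fun a => (e a).val) := rfl

theorem ListBlank.val_cons (a : Γ) (l : ListBlank Γ) :
    ListBlank.val e he (l.cons a) = e a + b * ListBlank.val e he l := by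
  induction l using ListBlank.induction_on with
  | h l => simp [ListBlank.val_mk, Nat.ofDigits_cons]

theorem ListBlank.val_eq (l : ListBlank Γ) :
    ListBlank.val e he l = e l.head + b * ListBlank.val e he l.tail := by
  rw [← ListBlank.val_cons, ListBlank.cons_head_tail]

theorem ListBlank.val_mod (l : ListBlank Γ) : ListBlank.val e he l % b = e l.head := by
  rw [ListBlank.val_eq, Nat.add_mul_mod_self_left, Nat.mod_eq_of_lt (e l.head).isLt]

theorem ListBlank.val_div (l : ListBlank Γ) :
    ListBlank.val e he l / b = ListBlank.val e he l.tail := by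
  rw [ListBlank.val_eq, Nat.add_mul_div_left _ _ (e l.head).pos, Nat.div_eq_of_lt (e l.head).isLt,
    Nat.zero_add]

/-- The instruction of a program for an instruction of a Turing machine. -/
def progStmt (e : Γ ≃ Fin b) : TM0.Stmt Γ → Bool ⊕ Fin b
  | .move Dir.left => Sum.inl false
  | .move Dir.right => Sum.inl true
  | .write a => Sum.inr (e a)

variable {Λ : Type*} [Inhabited Λ]

open Classical in
/-- The program of a Turing machine that stays in a set of states. -/
noncomputable def progOf (M : TM0.Machine Γ Λ) (S : Set Λ) (e : Γ ≃ Fin b) : Program S b :=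
  fun q i => (M q.1 (e.symm i)).bind fun x =>
    if h : x.1 ∈ S then some (⟨x.1, h⟩, progStmt e x.2) else none

/-- A configuration of a Turing machine is encoded by a configuration of its program. -/
def EncodesCfg (e : Γ ≃ Fin b) (he : (e default).val = 0) (S : Set Λ) (c : TM0.Cfg Γ Λ)
    (n : NumCfg S b) : Prop :=
  n.state.1 = c.q ∧ n.head = e c.Tape.head ∧ n.tape false = ListBlank.val e he c.Tape.left ∧
    n.tape true = ListBlank.val e he c.Tape.right

/-- Reading and removing the nearest symbol of a half-tape are remainder and quotient by `b`, and
pushing a symbol is `val_cons`. As `S` is closed under transitions, restricting to it loses no step.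
-/
theorem respects_progOf {M : TM0.Machine Γ Λ} {S : Set Λ} (hS : TM0.Supports M S) :
    StateTransition.Respects (TM0.step M) (numStep (progOf M S e)) (EncodesCfg e he S) := by
  rintro ⟨q, T⟩ ⟨⟨q', hq⟩, i, s⟩ ⟨h1, h2, h3, h4⟩
  simp only at h1 h2 h3 h4
  subst h1 h2
  cases hM : M q' T.head with
  | none => simp [TM0.step, hM, numStep, progOf]
  | some x =>
    obtain ⟨q'', st⟩ := x
    have hq'' : q'' ∈ S := hS.2 hM hq
    have hp : progOf M S e ⟨q', hq⟩ (e T.head) = some (⟨q'', hq''⟩, progStmt e st) := by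
      simp [progOf, hM, hq'']
    simp only [TM0.step, hM, Option.map_some]
    refine ⟨_, ?_, .single (by simp only [numStep, hp, Option.map_some, Option.mem_def]; rfl)⟩
    rcases st with (_ | _) | a
    · refine ⟨rfl, ?_, ?_, ?_⟩
      · exact Fin.ext ((congrArg (· % b) h3).trans (ListBlank.val_mod _))
      · simp [progStmt, moveTape, h3, ListBlank.val_div, Tape.move]
      · simp [progStmt, moveTape, h4, ListBlank.val_cons, Tape.move, Nat.add_comm]
    · refine ⟨rfl, ?_, ?_, ?_⟩
      · exact Fin.ext ((congrArg (· % b) h4).trans (ListBlank.val_mod _))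
      · simp [progStmt, moveTape, h3, ListBlank.val_cons, Tape.move, Nat.add_comm]
      · simp [progStmt, moveTape, h4, ListBlank.val_div, Tape.move]
    · exact ⟨rfl, rfl, h3, h4⟩

theorem numHalts_iff_dom {Q : Type*} {δ : Program Q b} {c : NumCfg Q b} :
    NumHalts δ c ↔ (StateTransition.eval (numStep δ) c).Dom := by
  rw [Part.dom_iff_mem]
  refine exists_congr fun c' => ?_
  rw [StateTransition.mem_eval]
  simp [numStep, StateTransition.Reaches]

theorem tm0_dom_iff_numHalts {M : TM0.Machine Γ Λ} {S : Set Λ} (hS : TM0.Supports M S)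
    (l : List Γ) (he : (e default).val = 0) (hb : 0 < b) :
    (TM0.eval M l).Dom ↔ NumHalts (progOf M S e)
      ⟨⟨default, hS.1⟩, ⟨Nat.ofDigits b (l.map fun a => (e a).val) % b, Nat.mod_lt _ hb⟩,
        fun d => if d then Nat.ofDigits b (l.map fun a => (e a).val) / b else 0⟩ := by
  rw [numHalts_iff_dom]
  refine (StateTransition.tr_eval_dom (respects_progOf (e := e) (he := he) hS)
    (a₁ := TM0.init l) ⟨rfl, ?_, rfl, ?_⟩).symm
  · exact Fin.ext (ListBlank.val_mod (e := e) (he := he) (ListBlank.mk l))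
  · exact ListBlank.val_div (e := e) (he := he) (ListBlank.mk l)

end TuringProgram

/-! ### Undecidability of halting for programs -/

theorem exists_equiv_fin_default (Γ : Type*) [Finite Γ] [Inhabited Γ] :
    ∃ (b : ℕ) (_ : 0 < b) (e : Γ ≃ Fin b), (e default).val = 0 := by
  obtain ⟨b, ⟨e⟩⟩ := Finite.exists_equiv_fin Γ
  have hb : 0 < b := (e default).pos
  -- The swap gives the blank the digit 0, as `ListBlank.val` requires.
  exact ⟨b, hb, e.trans (Equiv.swap (e default) ⟨0, hb⟩), by simp⟩

/-- Halting of a stack machine is halting of a program. -/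
theorem exists_program_of_tm2 {K Λ σ : Type} {Γ : K → Type} [DecidableEq K] [Inhabited Λ]
    [Inhabited σ] [Finite K] [∀ k, Finite (Γ k)] [Finite σ] (M : Λ → TM2.Stmt Γ Λ σ)
    {S : Finset Λ} (hS : TM2.Supports M S) (k : K) :
    ∃ (Q : Type) (_ : Finite Q) (b : ℕ) (hb : 0 < b) (e : TM2to1.Γ' K Γ → ℕ) (δ : Program Q b)
      (q : Q), ∀ L : List (Γ k), (TM2.eval M k L).Dom ↔
        NumHalts δ ⟨q, ⟨Nat.ofDigits b ((TM2to1.trInit k L).map e) % b, Nat.mod_lt _ hb⟩,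
          fun d => if d then Nat.ofDigits b ((TM2to1.trInit k L).map e) / b else 0⟩ := by
  have := Fintype.ofFinite σ
  have : Finite (TM2to1.Γ' K Γ) := inferInstanceAs (Finite (Bool × ∀ k, Option (Γ k)))
  obtain ⟨b, hb, e, he⟩ := exists_equiv_fin_default (TM2to1.Γ' K Γ)
  have hS0 := TM1to0.tr_supports _ (TM2to1.tr_supports M hS)
  refine ⟨_, Finset.finite_toSet _, b, hb, fun a => e a,
    progOf (TM1to0.tr (TM2to1.tr M)) _ e, ⟨default, hS0.1⟩, fun L => ?_⟩
  rw [← TM2to1.tr_eval_dom, ← TM1to0.tr_eval]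
  exact tm0_dom_iff_numHalts hS0 _ he hb

instance : Finite PartrecToTM2.K' := by
  refine Finite.of_surjective (fun i : Fin 4 => match i with
    | 0 => PartrecToTM2.K'.main
    | 1 => .rev
    | 2 => .aux
    | 3 => .stack) fun k => ?_
  cases k
  exacts [⟨0, rfl⟩, ⟨1, rfl⟩, ⟨2, rfl⟩, ⟨3, rfl⟩]

theorem exists_program_of_code (c : ToPartrec.Code) :
    ∃ (Q : Type) (_ : Finite Q) (b : ℕ) (hb : 0 < b)
      (e : TM2to1.Γ' PartrecToTM2.K' (fun _ => PartrecToTM2.Γ') → ℕ) (δ : Program Q b) (q : Q),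
      ∀ v : List ℕ, (c.eval v).Dom ↔ NumHalts δ
        ⟨q, ⟨Nat.ofDigits b ((TM2to1.trInit .main (PartrecToTM2.trList v)).map e) % b,
          Nat.mod_lt _ hb⟩, fun d => if d then
            Nat.ofDigits b ((TM2to1.trInit .main (PartrecToTM2.trList v)).map e) / b else 0⟩ := by
  -- `TM2.eval` starts at the default label, which is therefore chosen to be the entry point of `c`.
  let _ : Inhabited PartrecToTM2.Λ' := ⟨PartrecToTM2.trNormal c .halt⟩
  obtain ⟨Q, hQ, b, hb, e, δ, q, H⟩ := exists_program_of_tm2 PartrecToTM2.tr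
    (PartrecToTM2.tr_supports c .halt) PartrecToTM2.K'.main
  refine ⟨Q, hQ, b, hb, e, δ, q, fun v => ?_⟩
  rw [← H]
  have h1 : (TM2.init PartrecToTM2.K'.main (PartrecToTM2.trList v) : PartrecToTM2.Cfg') =
      PartrecToTM2.init c v := by
    simp only [TM2.init, PartrecToTM2.init]
    congr 1
    funext k
    cases k <;> rfl
  have h2 := PartrecToTM2.tr_eval c v
  rw [← h1] at h2
  exact (iff_of_eq (congrArg Part.Dom h2)).symm

/-! ### Computability of the encoded input -/

theorem trNat_of_ne_zero {n : ℕ} (hn : n ≠ 0) : PartrecToTM2.trNat n =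
    (if n % 2 = 0 then .bit0 else .bit1) :: PartrecToTM2.trNat (n / 2) := by
  obtain ⟨c, m, rfl⟩ : ∃ c m, n = Nat.bit c m := by
    refine ⟨decide (n % 2 = 1), n / 2, ?_⟩
    by_cases h : n % 2 = 1 <;> simp [Nat.bit, h] <;> omega
  have h1 : ((Nat.bit c m : ℕ) : Num) = cond c Num.bit1 Num.bit0 (m : Num) := Num.ofNat'_bit c m
  have h2 : Nat.bit c m / 2 = m := Nat.bit_div_two c m
  rw [h2, PartrecToTM2.trNat, PartrecToTM2.trNat, h1]
  cases c
  · have hm : (m : Num) ≠ 0 := by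
      intro h
      apply hn
      have : m = 0 := by exact_mod_cast h
      simp [this]
    cases hk : (m : Num) with
    | zero => exact absurd hk hm
    | pos p => simp [Num.bit0, PartrecToTM2.trNum, PartrecToTM2.trPosNum, Nat.bit]
  · cases hk : (m : Num) with
    | zero => simp [Num.bit1, PartrecToTM2.trNum, PartrecToTM2.trPosNum, Nat.bit]
    | pos p => simp [Num.bit1, PartrecToTM2.trNum, PartrecToTM2.trPosNum, Nat.bit]

/-- The function `f` is arbitrary, but only its values at the two bits enter, as constants of a
course-of-values recursion along `n / 2`. -/
theorem primrec_trNat_map (f : PartrecToTM2.Γ' → ℕ) :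
    Primrec fun n => (PartrecToTM2.trNat n).map f := by
  have key : Primrec₂ fun (_ : Unit) n => (PartrecToTM2.trNat n).map f := by
    -- The list `l` holds the values at all smaller arguments, so `l.length` is the current
    -- argument.
    refine Primrec.nat_strong_rec _ (g := fun _ l => if l.length = 0 then some [] else
      (l[l.length / 2]?).map fun t => (if l.length % 2 = 0 then f .bit0 else f .bit1) :: t)
      ?_ fun _ n => ?_
    · have hlen : Primrec fun x : Unit × List (List ℕ) => x.2.length :=
        Primrec.list_length.comp Primrec.snd
      refine Primrec.ite (Primrec.eq.comp hlen (Primrec.const 0)) (Primrec.const _) ?_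
      refine Primrec.option_map (Primrec.list_getElem?.comp Primrec.snd
        (Primrec.nat_div.comp hlen (Primrec.const 2))) ?_
      refine Primrec.list_cons.comp (Primrec.ite (Primrec.eq.comp (Primrec.nat_mod.comp
        (hlen.comp Primrec.fst) (Primrec.const 2)) (Primrec.const 0)) (Primrec.const _)
        (Primrec.const _)) Primrec.snd
    · by_cases hn : n = 0
      · simp [hn]
      · rw [trNat_of_ne_zero hn]
        have : n / 2 < n := by omega
        simp only [List.length_map, List.length_range, hn, if_false, List.getElem?_map,
          List.getElem?_range this, Option.map_some, List.map_cons, Option.some.injEq]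
        split_ifs <;> rfl
  exact key.comp (Primrec.const ()) Primrec.id

theorem computable_ofDigits_trInit (b : ℕ)
    (e : TM2to1.Γ' PartrecToTM2.K' (fun _ => PartrecToTM2.Γ') → ℕ) :
    Computable fun n => Nat.ofDigits b ((TM2to1.trInit .main (PartrecToTM2.trList [n])).map e) := by
  have h1 : ∀ n, (TM2to1.trInit .main (PartrecToTM2.trList [n])).map e =
      e (true, Function.update (fun _ => none) .main (some .cons)) ::
        ((PartrecToTM2.trNat n).map fun a =>
          e (false, Function.update (fun _ => none) .main (some a))).reverse := by
    intro n
    have : (PartrecToTM2.trList [n]).reverse = .cons :: (PartrecToTM2.trNat n).reverse := by simp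
    rw [TM2to1.trInit, this, ← List.map_reverse]
    exact congrArg (List.cons _) List.map_map
  simp only [h1, Nat.ofDigits_eq_foldr]
  refine Primrec.to_comp (Primrec.list_foldr (h := fun _ x => x.1 + b * x.2)
    (Primrec.list_cons.comp (Primrec.const _)
      (Primrec.list_reverse.comp (primrec_trNat_map _))) (Primrec.const 0) ?_)
  exact Primrec.nat_add.comp (Primrec.fst.comp Primrec.snd)
    (Primrec.nat_mul.comp (Primrec.const b) (Primrec.snd.comp Primrec.snd))

/-- There is a single code whose halting problem is undecidable. -/
theorem exists_code_not_computablePred :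
    ∃ c : ToPartrec.Code, ¬ ComputablePred fun n : ℕ => (c.eval [n]).Dom := by
  -- A universal function: the input is read as a program and run on 0, so one code carries the
  -- whole halting problem.
  have h1 : Partrec fun n : ℕ => (Denumerable.ofNat Nat.Partrec.Code n).eval 0 :=
    Nat.Partrec.Code.eval_part.comp (Computable.ofNat _) (Computable.const 0)
  obtain ⟨c, hc⟩ := ToPartrec.Code.exists_code (Nat.Partrec'.part_iff₁.2 h1)
  refine ⟨c, fun H => ComputablePred.halting_problem 0 ?_⟩
  have h2 : ∀ a : Nat.Partrec.Code, (c.eval [Encodable.encode a]).Dom ↔ (a.eval 0).Dom := by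
    intro a
    have := hc ⟨[Encodable.encode a], rfl⟩
    rw [show c.eval [Encodable.encode a] = _ from this]
    simp [List.Vector.head]
  simp only [← h2]
  exact ComputablePred.computable_iff.2 <| by
    obtain ⟨f, hf, hp⟩ := ComputablePred.computable_iff.1 H
    exact ⟨fun a => f (Encodable.encode a), hf.comp Computable.encode,
      funext fun a => congrFun hp (Encodable.encode a)⟩

end DataWordSynthesis

/-! ### Assembly of the reduction -/

theorem mainTheorem3 : ¬ ComputablePred DataWordSynthesis.PartSynthFO2SimSucc := by
  open DataWordSynthesis in
  obtain ⟨c, hc⟩ := exists_code_not_computablePred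
  obtain ⟨Q, _, b, hb, e, δ, q, H⟩ := exists_program_of_code c
  obtain ⟨Δ, K, s, f, hs, hf, hΔ, hreach⟩ :=
    exists_rules (CTrans δ) (.div q true 0) .halt
  refine not_computablePred_partSynth hs hf hΔ (computable_ofDigits_trInit b e) ?_
  simpa only [hreach, ← reaches_halt_iff hb, H] using hc
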